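/- Let $\mu$ be a probability measure on a measurable space $\mathcal X$, let $1\le m<n$ and $M\ge 1$ be integers, and let $K:\mathcal X^m\to[-1,1]$ be measurable and symmetric under permutations of its arguments. Let $\mathbf X=(X_1,\dots,X_n)\sim\mu^n$ be an i.i.d. sample and $\theta=\mathbb E[K(X_1,\dots,X_m)]$. Let $\mathbf W=(W_1,\dots,W_M)$ be a fixed (deterministic) design, that is, each $W_i\subset\{1,\dots,n\}$ has $|W_i|=m$, and let $$U_{\mathbf W}(\mathbf X)=\frac1M\sum_{i=1}^M K(\mathbf X^{W_i}),$$ where $K(\mathbf X^{W})=K(X_{j_1},\dots,X_{j_m})$ for any enumeration $j_1,\dots,j_m$ of $W$. For $k\ne l$ put $R_k=|\{i:k\in W_i\}|$, $R_{kl}=|\{i:k,l\in W_i\}|$ and $$A=\sum_{k=1}^n\frac{R_k^2}{M^2},\qquad B=\sum_{k,l:\,k\neq l}\frac{R_{kl}^2}{M^2}\ \text{ (ordered pairs)},\qquad C=\max_k\frac{R_k}{M}.$$ For $f:\mathcal X^m\to\mathbb R$ and $y,y'\in\mathcal X$ let $D^k_{y,y'}f(\mathbf x)=f(x_1,\dots,x_{k-1},y,x_{k+1},\dots,x_m)-f(x_1,\dots,x_{k-1},y',x_{k+1},\dots,x_m)$.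 With $X_1,\dots,X_m,X_1',X_2'$ i.i.d. with law $\mu$ let $\sigma_1^2=\operatorname{Var}\big[\mathbb E[K(X_1,\dots,X_m)\mid X_1]\big]$, $$\beta=\mathbb E\Big[\big(D^1_{X_1,X_1'}D^2_{X_2,X_2'}K(X_1,\dots,X_m)\big)^2\Big],\qquad \gamma=\sup_{\mathbf x\in\mathcal X^m,\;y,y'\in\mathcal X}\mathbb E\Big[\big(D^1_{y,y'}D^2_{X_2,X_2'}K(x_1,\dots,x_m)\big)^2\Big],$$ and $\alpha=\sqrt{\beta/2}+\sqrt\gamma$ (for $m=1$ put $\beta=\gamma=0$; in that case $B=0$). Then for every $t>0$ $$\Pr\{U_{\mathbf W}(\mathbf X)-\theta>t\}\le\exp\left(\frac{-t^2}{2A\sigma_1^2+B\beta/2+\left(\sqrt{B\gamma}+4C/3\right)t}\right),$$ and for every $0<\delta\le 1/e$, with probability at least $1-\delta$, $$U_{\mathbf W}(\mathbf X)-\theta\le\sqrt{2A\sigma_1^2\ln(1/\delta)}+\left(\alpha\sqrt B+4C/3\right)\ln(1/\delta).$$ -/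

import Mathlib

open MeasureTheory ProbabilityTheory

namespace IncompleteU

/-- A design `(W₁, …, W_M)`: a sequence of `M` subsets of `{1, …, n}`, each of cardinality `m`. -/
abbrev Design (n m M : ℕ) : Type := Fin M → {W : Finset (Fin n) // W.card = m}

section Design

variable {n m M : ℕ}

/-- `R_k(W)`, the number of indices `i` with `k ∈ W_i`. -/
def R (W : Design n m M) (k : Fin n) : ℕ :=
  (Finset.univ.filter fun i : Fin M => k ∈ (W i).1).card

/-- `R_{k,l}(W)`, the number of indices `i` with `k ∈ W_i` and `l ∈ W_i`. -/
def R₂ (W : Design n m M) (k l : Fin n) : ℕ :=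
  (Finset.univ.filter fun i : Fin M => k ∈ (W i).1 ∧ l ∈ (W i).1).card

/-- `A(W) = ∑_k R_k² / M²`. -/
noncomputable def A (W : Design n m M) : ℝ :=
  ∑ k : Fin n, (R W k : ℝ) ^ 2 / (M : ℝ) ^ 2

/-- `B(W) = ∑_{k ≠ l} R_{k,l}² / M²`, summed over ordered pairs. -/
noncomputable def B (W : Design n m M) : ℝ :=
  ∑ k : Fin n, ∑ l ∈ Finset.univ.filter (fun l : Fin n => k ≠ l),
    (R₂ W k l : ℝ) ^ 2 / (M : ℝ) ^ 2

/-- `C(W) = max_k R_k / M`. -/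
noncomputable def C (W : Design n m M) : ℝ :=
  ⨆ k : Fin n, (R W k : ℝ) / (M : ℝ)

end Design

section Kernel

variable {𝒳 : Type*} {n m M : ℕ}

/-- `x^W`: the coordinates of `x` with index in `W`, enumerated in increasing order. -/
def restrict (x : Fin n → 𝒳) (W : {W : Finset (Fin n) // W.card = m}) : Fin m → 𝒳 :=
  fun j => x (W.1.orderEmbOfFin W.2 j)

/-- The incomplete U-statistic `U_W(x) = (1/M) ∑_i K(x^{W_i})`. -/
noncomputable def U (K : (Fin m → 𝒳) → ℝ) (W : Design n m M) (x : Fin n → 𝒳) : ℝ :=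
  (1 / (M : ℝ)) * ∑ i : Fin M, K (restrict x (W i))

/-- Permutation symmetry of a kernel. -/
def IsSymmetric (K : (Fin m → 𝒳) → ℝ) : Prop :=
  ∀ (π : Equiv.Perm (Fin m)) (x : Fin m → 𝒳), K (fun i => x (π i)) = K x

/-- The partial difference operator: `D^k_{y,y'} f (x)` is `f` at `x` with the `k`-th coordinate
replaced by `y`, minus `f` at `x` with the `k`-th coordinate replaced by `y'`. -/
def D (k : Fin m) (y y' : 𝒳) (f : (Fin m → 𝒳) → ℝ) (x : Fin m → 𝒳) : ℝ :=
  f (Function.update x k y) - f (Function.update x k y')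

variable [MeasurableSpace 𝒳]

/-- `θ = E[K(X₁, …, X_m)]` for `X₁, …, X_m` iid with law `μ`. -/
noncomputable def θ (μ : Measure 𝒳) (K : (Fin m → 𝒳) → ℝ) : ℝ :=
  ∫ x, K x ∂(Measure.pi fun _ : Fin m => μ)

/-- The σ-algebra on `𝒳^m` generated by the first `k` coordinates. -/
abbrev sigmaFirst (𝒳 : Type*) [MeasurableSpace 𝒳] (m k : ℕ) : MeasurableSpace (Fin m → 𝒳) :=
  MeasurableSpace.comap
    (fun (x : Fin m → 𝒳) (i : {i : Fin m // (i : ℕ) < k}) => x i.1) MeasurableSpace.pi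

/-- The conditional variance `σ_k² = Var[E[K(X₁, …, X_m) | X₁, …, X_k]]`. -/
noncomputable def sigmaSq (μ : Measure 𝒳) (K : (Fin m → 𝒳) → ℝ) (k : ℕ) : ℝ :=
  variance (condExp (sigmaFirst 𝒳 m k) (Measure.pi fun _ : Fin m => μ) K)
    (Measure.pi fun _ : Fin m => μ)

/-- `β(K) = E[(D¹_{X₁,X₁'} D²_{X₂,X₂'} K(X₁, …, X_m))²]`, where `p.1` stands for `(X₁, …, X_m)` and
`p.2` for `(X₁', X₂')`. It is set to `0` when `m < 2` and there is no second argument. -/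
noncomputable def β (μ : Measure 𝒳) (K : (Fin m → 𝒳) → ℝ) : ℝ :=
  if h : 2 ≤ m then
    ∫ p : (Fin m → 𝒳) × (𝒳 × 𝒳),
      (D ⟨0, by omega⟩ (p.1 ⟨0, by omega⟩) p.2.1
        (D ⟨1, by omega⟩ (p.1 ⟨1, by omega⟩) p.2.2 K) p.1) ^ 2
      ∂((Measure.pi fun _ : Fin m => μ).prod (μ.prod μ))
  else 0

/-- `γ(K) = sup_{x ∈ 𝒳^m; y, y' ∈ 𝒳} E[(D¹_{y,y'} D²_{X₂,X₂'} K(x₁, …, x_m))²]`, where `z` stands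
for `(X₂, X₂')`. It is set to `0` when `m < 2` and there is no second argument. -/
noncomputable def γ (μ : Measure 𝒳) (K : (Fin m → 𝒳) → ℝ) : ℝ :=
  if h : 2 ≤ m then
    ⨆ q : (Fin m → 𝒳) × 𝒳 × 𝒳,
      ∫ z : 𝒳 × 𝒳,
        (D ⟨0, by omega⟩ q.2.1 q.2.2 (D ⟨1, by omega⟩ z.1 z.2 K) q.1) ^ 2 ∂(μ.prod μ)
  else 0

/-- `α(K) = √(β(K)/2) + √γ(K)`. -/
noncomputable def α (μ : Measure 𝒳) (K : (Fin m → 𝒳) → ℝ) : ℝ :=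
  √(β μ K / 2) + √(γ μ K)

end Kernel

end IncompleteU

/-! The proof is the entropy method with a random variance proxy. Write f = U_W, Ent(e^F) = E[F e^F]
- E[e^F] log E[e^F], and V = ∑_k Var_k f, the sum of the variances of f in each argument with the
others frozen (`varSum`). Tensorization (`entropy_le_sum`) reduces entropy to one coordinate at a
time, where a Bernstein-type estimate (`entropy_le_variance`) yields Ent(e^{sf}) ≤ s²/(2(1 - sb/3)²)
· E[V e^{sf}] with b = 2C.

Bounding V by its supremum would lose the variance term A σ₁². Instead the variational inequality
`integral_exp_mul_le` decouples V from e^{sf}, at the price of log E[e^{θV}]. This is affordable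
because √V behaves like a Euclidean norm: replacing the l-th argument moves it by at most d_l, a
quantity controlled by mixed second differences (`sqrt_varSum_update_le`). For U_W these satisfy ∑
d_l² ≤ Bγ. A second round of the entropy method, now applied to V (`entropy_le_of_sqrt_range`,
`log_mgf_varSum_le`), bounds its exponential moment through E[V] alone. Solving for the entropy
(`entropy_le_bernstein`), integrating in s and applying Chernoff's bound give a Bernstein inequality
with variance proxy E[V] and scale 2b/3 + √(Bγ).

It remains to bound E[V]. The Efron–Stein inequality applied to each first difference of f
(`integral_varSum_le`) separates the first-order projection, which produces A σ₁², from the mixed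
second differences, which produce Bβ/4. The high-probability form inverts the tail; δ ≤ 1/e makes
ln(1/δ) ≥ 1, so that the β-term can be moved out of the square root. -/

set_option linter.unusedSectionVars false

/-! ### Bounded measurable functions and averaging over coordinates of a product space. -/

namespace IncompleteU

/-- Bounded measurable real functions. -/
def BddMeas {α : Type*} [MeasurableSpace α] (f : α → ℝ) : Prop :=
  Measurable f ∧ ∃ c : ℝ, ∀ x, |f x| ≤ c

namespace BddMeas

variable {α β' : Type*} [MeasurableSpace α] [MeasurableSpace β'] {f g : α → ℝ}

lemma integrable (hf : BddMeas f) (ν : Measure α) [IsFiniteMeasure ν] : Integrable f ν := by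
  obtain ⟨hm, c, hc⟩ := hf
  exact Integrable.of_bound hm.aestronglyMeasurable c (.of_forall hc)

lemma const (c : ℝ) : BddMeas (fun _ : α => c) := ⟨measurable_const, |c|, fun _ => le_rfl⟩

lemma add (hf : BddMeas f) (hg : BddMeas g) : BddMeas (fun x => f x + g x) := by
  obtain ⟨hm, c, hc⟩ := hf
  obtain ⟨hm', c', hc'⟩ := hg
  exact ⟨hm.add hm', c + c', fun x => (abs_add_le _ _).trans (add_le_add (hc x) (hc' x))⟩

lemma neg (hf : BddMeas f) : BddMeas (fun x => -f x) := by
  obtain ⟨hm, c, hc⟩ := hf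
  exact ⟨hm.neg, c, fun x => by simpa using hc x⟩

lemma sub (hf : BddMeas f) (hg : BddMeas g) : BddMeas (fun x => f x - g x) := by
  simpa [sub_eq_add_neg] using hf.add hg.neg

lemma mul (hf : BddMeas f) (hg : BddMeas g) : BddMeas (fun x => f x * g x) := by
  obtain ⟨hm, c, hc⟩ := hf
  obtain ⟨hm', c', hc'⟩ := hg
  refine ⟨hm.mul hm', c * c', fun x => ?_⟩
  rw [abs_mul]
  exact mul_le_mul (hc x) (hc' x) (abs_nonneg _) ((abs_nonneg _).trans (hc x))

lemma const_mul (a : ℝ) (hf : BddMeas f) : BddMeas (fun x => a * f x) := (const a).mul hf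

lemma sq (hf : BddMeas f) : BddMeas (fun x => f x ^ 2) := by
  simpa [_root_.sq] using hf.mul hf

lemma exp (hf : BddMeas f) : BddMeas (fun x => Real.exp (f x)) := by
  obtain ⟨hm, c, hc⟩ := hf
  refine ⟨hm.exp, Real.exp c, fun x => ?_⟩
  rw [Real.abs_exp]
  exact Real.exp_le_exp.2 ((le_abs_self _).trans (hc x))

lemma sum {ι : Type*} (s : Finset ι) {F : ι → α → ℝ} (h : ∀ i ∈ s, BddMeas (F i)) :
    BddMeas (fun x => ∑ i ∈ s, F i x) := by
  classical
  induction s using Finset.induction_on with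
  | empty => simpa using const 0
  | insert a s ha ih =>
    simp_rw [Finset.sum_insert ha]
    exact (h a (by simp)).add (ih fun i hi => h i (by simp [hi]))

lemma comp (hf : BddMeas f) {φ : β' → α} (hφ : Measurable φ) : BddMeas (fun x => f (φ x)) :=
  ⟨hf.1.comp hφ, hf.2.imp fun _ h _ => h _⟩

lemma integral_right {h : α × β' → ℝ} (hh : BddMeas h) (ν : Measure β') [IsProbabilityMeasure ν] :
    BddMeas (fun x => ∫ y, h (x, y) ∂ν) := by
  obtain ⟨hm, c, hc⟩ := hh
  refine ⟨(hm.stronglyMeasurable.integral_prod_right' (ν := ν)).measurable, c, fun x => ?_⟩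
  have := norm_integral_le_of_norm_le_const (μ := ν) (f := fun y => h (x, y)) (C := c)
    (.of_forall fun y => hc _)
  simpa using this

end BddMeas

variable {𝒳 : Type*} [MeasurableSpace 𝒳] {n m : ℕ}

lemma measurable_update_prod (k : Fin n) :
    Measurable (fun p : (Fin n → 𝒳) × 𝒳 => Function.update p.1 k p.2) := by
  refine measurable_pi_lambda _ fun i => ?_
  by_cases h : i = k
  · subst h; simpa using measurable_snd
  · simp only [Function.update_of_ne h]
    exact (measurable_pi_apply i).comp measurable_fst

section Product

variable (μ : Measure 𝒳) [IsProbabilityMeasure μ]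

/-- Resampling one coordinate independently preserves the product law; this is what makes `avg` a
conditional expectation. -/
lemma measurePreserving_update (k : Fin n) :
    MeasurePreserving (fun p : (Fin n → 𝒳) × 𝒳 => Function.update p.1 k p.2)
      ((Measure.pi fun _ : Fin n => μ).prod μ) (Measure.pi fun _ : Fin n => μ) := by
  refine ⟨measurable_update_prod k, ?_⟩
  refine (Measure.pi_eq fun s hs => ?_).symm
  rw [Measure.map_apply (measurable_update_prod k) (MeasurableSet.univ_pi hs)]
  have : (fun p : (Fin n → 𝒳) × 𝒳 => Function.update p.1 k p.2) ⁻¹' (Set.univ.pi s)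
      = (Set.univ.pi (Function.update s k Set.univ)) ×ˢ s k := by
    ext p
    simp only [Set.mem_preimage, Set.mem_pi, Set.mem_univ, true_imp_iff, Set.mem_prod]
    constructor
    · intro h
      refine ⟨fun i => ?_, by simpa using h k⟩
      by_cases hi : i = k
      · subst hi; simp
      · simpa [hi] using h i
    · rintro ⟨h, h'⟩ i
      by_cases hi : i = k
      · subst hi; simpa using h'
      · simpa [hi] using h i
  rw [this, Measure.prod_prod, Measure.pi_pi, ← Finset.mul_prod_erase _ _ (Finset.mem_univ k),
    ← Finset.mul_prod_erase _ (fun i => μ (s i)) (Finset.mem_univ k)]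
  simp only [Function.update_self, measure_univ, one_mul]
  rw [mul_comm]
  congr 1
  refine Finset.prod_congr rfl fun i hi => ?_
  rw [Function.update_of_ne (Finset.ne_of_mem_erase hi)]

lemma measurePreserving_comp_injective {e : Fin m → Fin n} (he : Function.Injective e) :
    MeasurePreserving (fun (x : Fin n → 𝒳) j => x (e j))
      (Measure.pi fun _ : Fin n => μ) (Measure.pi fun _ : Fin m => μ) := by
  have hm : Measurable (fun (x : Fin n → 𝒳) j => x (e j)) := by fun_prop
  refine ⟨hm, (Measure.pi_eq fun s hs => ?_).symm⟩
  rw [Measure.map_apply hm (MeasurableSet.univ_pi hs)]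
  classical
  have : (fun (x : Fin n → 𝒳) j => x (e j)) ⁻¹' (Set.univ.pi s)
      = Set.univ.pi (Function.extend e s fun _ => Set.univ) := by
    ext x
    simp only [Set.mem_preimage, Set.mem_pi, Set.mem_univ, true_imp_iff]
    constructor
    · intro h i
      by_cases hi : ∃ j, e j = i
      · obtain ⟨j, rfl⟩ := hi
        simpa [he.extend_apply] using h j
      · simp [Function.extend_apply' _ _ _ hi]
    · intro h j
      simpa [he.extend_apply] using h (e j)
  rw [this, Measure.pi_pi, ← Finset.prod_subset (Finset.subset_univ (Finset.univ.image e)),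
    Finset.prod_image fun _ _ _ _ h => he h]
  · simp [he.extend_apply]
  · intro i _ hi
    rw [Function.extend_apply' _ _ _ (by simpa using hi)]
    simp

/-- Integration over the `k`-th coordinate. -/
noncomputable def avg (k : Fin n) (f : (Fin n → 𝒳) → ℝ) (x : Fin n → 𝒳) : ℝ :=
  ∫ y, f (Function.update x k y) ∂μ

variable {μ} {f g : (Fin n → 𝒳) → ℝ}

lemma BddMeas.update_prod (hf : BddMeas f) (k : Fin n) :
    BddMeas (fun p : (Fin n → 𝒳) × 𝒳 => f (Function.update p.1 k p.2)) :=
  hf.comp (measurable_update_prod k)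

lemma BddMeas.update (hf : BddMeas f) (k : Fin n) (x : Fin n → 𝒳) :
    BddMeas (fun y => f (Function.update x k y)) :=
  hf.comp (measurable_update x)

lemma BddMeas.avg (hf : BddMeas f) (k : Fin n) : BddMeas (avg μ k f) :=
  (hf.update_prod k).integral_right μ

lemma integral_avg (hf : BddMeas f) (k : Fin n) :
    ∫ x, avg μ k f x ∂(Measure.pi fun _ : Fin n => μ) = ∫ x, f x ∂(Measure.pi fun _ : Fin n => μ) := by
  have h := (measurePreserving_update μ k).map_eq
  conv_rhs => rw [← h]
  rw [integral_map (measurable_update_prod k).aemeasurable hf.1.aestronglyMeasurable,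
    integral_prod _ ((hf.update_prod k).integrable _)]
  rfl

@[simp] lemma avg_update (k : Fin n) (f : (Fin n → 𝒳) → ℝ) (x : Fin n → 𝒳) (y : 𝒳) :
    avg μ k f (Function.update x k y) = avg μ k f x := by
  simp [avg]

lemma avg_mul_left {k : Fin n} (h : ∀ x y, g (Function.update x k y) = g x) (x : Fin n → 𝒳) :
    avg μ k (fun x => g x * f x) x = g x * avg μ k f x := by
  simp [avg, h, integral_const_mul]

lemma avg_mono (hf : BddMeas f) (hg : BddMeas g) (h : ∀ x, f x ≤ g x) (k : Fin n)
    (x : Fin n → 𝒳) : avg μ k f x ≤ avg μ k g x :=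
  integral_mono ((hf.update k x).integrable _) ((hg.update k x).integrable _) fun _ => h _

lemma avg_sub (hf : BddMeas f) (hg : BddMeas g) (k : Fin n) (x : Fin n → 𝒳) :
    avg μ k (fun x => f x - g x) x = avg μ k f x - avg μ k g x :=
  integral_sub ((hf.update k x).integrable _) ((hg.update k x).integrable _)

variable (μ) in
/-- Successive integration over the coordinates in a list. -/
noncomputable def avgList (l : List (Fin n)) (f : (Fin n → 𝒳) → ℝ) : (Fin n → 𝒳) → ℝ :=
  l.foldr (avg μ) f

@[simp] lemma avgList_nil (f : (Fin n → 𝒳) → ℝ) : avgList μ [] f = f := rfl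

@[simp] lemma avgList_cons (k : Fin n) (l : List (Fin n)) (f : (Fin n → 𝒳) → ℝ) :
    avgList μ (k :: l) f = avg μ k (avgList μ l f) := rfl

lemma BddMeas.avgList (hf : BddMeas f) (l : List (Fin n)) : BddMeas (avgList μ l f) := by
  induction l with
  | nil => simpa
  | cons k l ih => exact ih.avg k

lemma integral_avgList (hf : BddMeas f) (l : List (Fin n)) :
    ∫ x, avgList μ l f x ∂(Measure.pi fun _ : Fin n => μ)
      = ∫ x, f x ∂(Measure.pi fun _ : Fin n => μ) := by
  induction l with
  | nil => rfl
  | cons k l ih => rw [avgList_cons, integral_avg (hf.avgList l), ih]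

lemma avgList_update {l : List (Fin n)} {k : Fin n} (hk : k ∈ l) (f : (Fin n → 𝒳) → ℝ)
    (x : Fin n → 𝒳) (y : 𝒳) : avgList μ l f (Function.update x k y) = avgList μ l f x := by
  induction l generalizing x with
  | nil => simp at hk
  | cons j l ih =>
    by_cases h : k = j
    · subst h; simp
    · have hk' : k ∈ l := by simpa [h] using hk
      simp only [avgList_cons, avg]
      simp_rw [Function.update_comm h]
      exact integral_congr_ae (.of_forall fun z => ih hk' _)

lemma eq_of_update_eq {l : List (Fin n)} {g : (Fin n → 𝒳) → ℝ}
    (h : ∀ k ∈ l, ∀ x y, g (Function.update x k y) = g x) (x x' : Fin n → 𝒳)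
    (hx : ∀ k, k ∉ l → x k = x' k) : g x = g x' := by
  induction l generalizing x with
  | nil => rw [funext fun k => hx k (by simp)]
  | cons j l ih =>
    rw [← h j (by simp) x (x' j)]
    refine ih (fun k hk => h k (by simp [hk])) _ fun k hk => ?_
    by_cases hkj : k = j
    · subst hkj; simp
    · rw [Function.update_of_ne hkj]; exact hx k (by simp [hkj, hk])

lemma avgList_univ (hf : BddMeas f) {l : List (Fin n)} (hl : ∀ k, k ∈ l) (x : Fin n → 𝒳) :
    avgList μ l f x = ∫ x, f x ∂(Measure.pi fun _ : Fin n => μ) := by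
  rw [← integral_avgList hf l]
  have : ∀ x', avgList μ l f x' = avgList μ l f x := fun x' =>
    eq_of_update_eq (l := l) (fun k hk x y => avgList_update hk f x y) _ _
      fun k hk => absurd (hl k) hk
  simp [this]

lemma le_avgList (hf : BddMeas f) {c : ℝ} (h : ∀ x, c ≤ f x) (l : List (Fin n))
    (x : Fin n → 𝒳) : c ≤ avgList μ l f x := by
  induction l generalizing x with
  | nil => exact h x
  | cons k l ih =>
    have := avg_mono (μ := μ) (BddMeas.const c) (hf.avgList (μ := μ) l) (fun x => ih x) k x
    simpa [avg] using this

end Product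

end IncompleteU

/-! ### Variational inequality and tensorization of entropy. -/

namespace IncompleteU

lemma BddMeas.log {α : Type*} [MeasurableSpace α] {f : α → ℝ} (hf : BddMeas f) {c : ℝ}
    (hc : 0 < c) (h : ∀ x, c ≤ f x) : BddMeas (fun x => Real.log (f x)) := by
  obtain ⟨hm, C, hC⟩ := hf
  refine ⟨hm.log, max |Real.log c| |Real.log C|, fun x => ?_⟩
  exact abs_le_max_abs_abs (Real.log_le_log hc (h x))
    (Real.log_le_log (hc.trans_le (h x)) ((le_abs_self _).trans (hC x)))

/-- Young's inequality for the exponential: this is x + 1 ≤ e^x at x = log w + h - a, multiplied by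
e^a. Integrated with suitable weights w, it supplies every duality and Jensen step for entropy
below. -/
lemma exp_sub_le_exp_mul (a h : ℝ) {w : ℝ} (hw : 0 < w) :
    Real.exp a - w * Real.exp h ≤ Real.exp a * (a - Real.log w - h) := by
  have h1 := Real.add_one_le_exp (Real.log w + h - a)
  have h2 : Real.exp a * Real.exp (Real.log w + h - a) = w * Real.exp h := by
    rw [← Real.exp_add, show a + (Real.log w + h - a) = Real.log w + h by ring, Real.exp_add,
      Real.exp_log hw]
  nlinarith [Real.exp_pos a]

lemma exists_exp_lower {α : Type*} [MeasurableSpace α] {f : α → ℝ} (hf : BddMeas f) :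
    ∃ c : ℝ, 0 < c ∧ ∀ x, c ≤ Real.exp (f x) := by
  obtain ⟨-, c, hc⟩ := hf
  exact ⟨Real.exp (-c), Real.exp_pos _, fun x => Real.exp_le_exp.2 (abs_le.1 (hc x)).1⟩

lemma integral_exp_pos_of_bddMeas {α : Type*} [MeasurableSpace α] (ν : Measure α) [IsProbabilityMeasure ν]
    {f : α → ℝ} (hf : BddMeas f) : 0 < ∫ x, Real.exp (f x) ∂ν :=
  integral_exp_pos (hf.exp.integrable ν)

/-- The variational (Donsker–Varadhan) inequality. -/
lemma integral_exp_mul_le {α : Type*} [MeasurableSpace α] (ν : Measure α) [IsProbabilityMeasure ν]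
    {F h : α → ℝ} (hF : BddMeas F) (hh : BddMeas h) :
    ∫ x, Real.exp (F x) * h x ∂ν - (∫ x, Real.exp (F x) ∂ν) * Real.log (∫ x, Real.exp (h x) ∂ν)
      ≤ ∫ x, Real.exp (F x) * F x ∂ν
        - (∫ x, Real.exp (F x) ∂ν) * Real.log (∫ x, Real.exp (F x) ∂ν) := by
  set N := ∫ x, Real.exp (F x) ∂ν with hN
  set H := ∫ x, Real.exp (h x) ∂ν with hH
  have hNpos : 0 < N := integral_exp_pos_of_bddMeas ν hF
  have hHpos : 0 < H := integral_exp_pos_of_bddMeas ν hh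
  -- The weight N / H makes the left-hand side integrate to zero.
  have key : ∫ x, (Real.exp (F x) - N / H * Real.exp (h x)) ∂ν
      ≤ ∫ x, (Real.exp (F x) * F x - Real.exp (F x) * h x
        - Real.log (N / H) * Real.exp (F x)) ∂ν := by
    refine integral_mono ((hF.exp.sub (hh.exp.const_mul _)).integrable ν)
      ((((hF.exp.mul hF).sub (hF.exp.mul hh)).sub (hF.exp.const_mul _)).integrable ν) fun x => ?_
    have := exp_sub_le_exp_mul (F x) (h x) (div_pos hNpos hHpos)
    simp only
    linarith
  rw [integral_sub (hF.exp.integrable ν) ((hh.exp.const_mul _).integrable ν), integral_sub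
    (((hF.exp.mul hF).sub (hF.exp.mul hh)).integrable ν) ((hF.exp.const_mul _).integrable ν),
    integral_sub ((hF.exp.mul hF).integrable ν) ((hF.exp.mul hh).integrable ν),
    integral_const_mul, integral_const_mul, ← hN, ← hH, Real.log_div hNpos.ne' hHpos.ne',
    div_mul_cancel₀ _ hHpos.ne'] at key
  linarith

variable {𝒳 : Type*} [MeasurableSpace 𝒳] {n : ℕ} {μ : Measure 𝒳} [IsProbabilityMeasure μ]

lemma bddMeas_log_avg_exp {F : (Fin n → 𝒳) → ℝ} (hF : BddMeas F) (k : Fin n) :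
    BddMeas (fun x => Real.log (avg μ k (fun x => Real.exp (F x)) x)) := by
  obtain ⟨c, hc, h⟩ := exists_exp_lower hF
  exact (hF.exp.avg k).log hc fun x => le_avgList (μ := μ) hF.exp h [k] x

/-- The increment h of the logarithms satisfies E_k[e^h] = 1, because averaging the numerator of e^h
over the k-th coordinate gives its denominator. The variational inequality in that coordinate alone
therefore bounds E[e^F h] by the k-th conditional entropy. -/
lemma entropy_telescope {F : (Fin n → 𝒳) → ℝ} (hF : BddMeas F) (k : Fin n) (l : List (Fin n)) :
    ∫ x, Real.exp (F x) * (Real.log (avgList μ l (fun x => Real.exp (F x)) x)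
        - Real.log (avgList μ (k :: l) (fun x => Real.exp (F x)) x)) ∂(Measure.pi fun _ => μ)
      ≤ ∫ x, Real.exp (F x) * (F x - Real.log (avg μ k (fun x => Real.exp (F x)) x))
        ∂(Measure.pi fun _ => μ) := by
  obtain ⟨c, hc, hcF⟩ := exists_exp_lower hF
  set E : (Fin n → 𝒳) → ℝ := fun x => Real.exp (F x) with hE
  have hEb : BddMeas E := hF.exp
  have hpos : ∀ l x, 0 < avgList μ l E x := fun l x => hc.trans_le (le_avgList hEb hcF l x)
  have hlog : ∀ l, BddMeas (fun x => Real.log (avgList μ l E x)) := fun l =>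
    (hEb.avgList l).log hc fun x => le_avgList hEb hcF l x
  set h : (Fin n → 𝒳) → ℝ := fun x => Real.log (avgList μ l E x)
    - Real.log (avgList μ (k :: l) E x) with hh
  have hhb : BddMeas h := (hlog l).sub (hlog (k :: l))
  have hexph : ∀ x, Real.exp (h x) = (avgList μ (k :: l) E x)⁻¹ * avgList μ l E x := fun x => by
    rw [hh]
    simp only
    rw [Real.exp_sub, Real.exp_log (hpos _ _), Real.exp_log (hpos _ _)]
    field_simp
  have hone : ∀ x, avg μ k (fun x => Real.exp (h x)) x = 1 := fun x => by
    simp_rw [hexph]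
    rw [avg_mul_left (fun x y => by rw [avgList_cons, avg_update])]
    exact inv_mul_cancel₀ (hpos (k :: l) x).ne'
  have hw : ∫ x, avg μ k E x * Real.exp (h x) ∂(Measure.pi fun _ => μ)
      = ∫ x, E x ∂(Measure.pi fun _ => μ) := by
    rw [← integral_avg ((hEb.avg k).mul hhb.exp) k, ← integral_avg hEb k]
    congr 1
    ext x
    rw [avg_mul_left (fun x y => avg_update k E x y), hone, mul_one]
  have key : ∫ x, (E x - avg μ k E x * Real.exp (h x)) ∂(Measure.pi fun _ => μ)
      ≤ ∫ x, (E x * (F x - Real.log (avg μ k E x)) - E x * h x) ∂(Measure.pi fun _ => μ) := by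
    refine integral_mono ((hEb.sub ((hEb.avg k).mul hhb.exp)).integrable _)
      (((hEb.mul (hF.sub (bddMeas_log_avg_exp hF k))).sub (hEb.mul hhb)).integrable _) fun x => ?_
    have := exp_sub_le_exp_mul (F x) (h x) (hpos [k] x)
    simp only [avgList_cons, avgList_nil] at this
    simp only [hE] at this ⊢
    linarith
  rw [integral_sub (hEb.integrable _) (((hEb.avg k).mul hhb.exp).integrable _), hw, sub_self,
    integral_sub ((hEb.mul (hF.sub (bddMeas_log_avg_exp hF k))).integrable _)
      ((hEb.mul hhb).integrable _)] at key
  linarith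

lemma entropy_avgList_le {F : (Fin n → 𝒳) → ℝ} (hF : BddMeas F) (l : List (Fin n)) :
    ∫ x, Real.exp (F x) * (F x - Real.log (avgList μ l (fun x => Real.exp (F x)) x))
        ∂(Measure.pi fun _ => μ)
      ≤ (l.map fun k => ∫ x, Real.exp (F x)
        * (F x - Real.log (avg μ k (fun x => Real.exp (F x)) x)) ∂(Measure.pi fun _ => μ)).sum := by
  obtain ⟨c, hc, hcF⟩ := exists_exp_lower hF
  have hlog : ∀ l, BddMeas (fun x => Real.log (avgList μ l (fun x => Real.exp (F x)) x)) := fun l =>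
    (hF.exp.avgList l).log hc fun x => le_avgList hF.exp hcF l x
  induction l with
  | nil => simp
  | cons k l ih =>
    rw [List.map_cons, List.sum_cons]
    refine le_trans (le_of_eq ?_) (add_le_add (entropy_telescope hF k l) ih)
    rw [← integral_add ((hF.exp.mul ((hlog l).sub (hlog (k :: l)))).integrable _)
      ((hF.exp.mul (hF.sub (hlog l))).integrable _)]
    congr 1
    ext x
    ring

/-- Tensorization of entropy. -/
theorem entropy_le_sum {F : (Fin n → 𝒳) → ℝ} (hF : BddMeas F) :
    ∫ x, Real.exp (F x) * F x ∂(Measure.pi fun _ => μ)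
        - (∫ x, Real.exp (F x) ∂(Measure.pi fun _ => μ))
          * Real.log (∫ x, Real.exp (F x) ∂(Measure.pi fun _ => μ))
      ≤ ∑ k, ∫ x, Real.exp (F x)
        * (F x - Real.log (avg μ k (fun x => Real.exp (F x)) x)) ∂(Measure.pi fun _ => μ) := by
  have := entropy_avgList_le (μ := μ) hF (Finset.univ : Finset (Fin n)).toList
  rw [Finset.sum_map_toList] at this
  refine le_trans (le_of_eq ?_) this
  simp_rw [avgList_univ hF.exp (l := (Finset.univ : Finset (Fin n)).toList) (by simp), mul_sub]
  rw [integral_sub ((hF.exp.mul hF).integrable _)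
    ((hF.exp.mul (BddMeas.const _)).integrable _), integral_mul_const]

end IncompleteU

/-! ### Entropy estimates for one variable. -/

namespace IncompleteU

lemma hasDerivAt_psi_gap {u : ℝ} (hu : u < 3) :
    HasDerivAt (fun u : ℝ => u ^ 2 / 2 / (1 - u / 3) ^ 2 - (u * Real.exp u - Real.exp u + 1))
      (u * (((1 - u / 3) ^ 3)⁻¹ - Real.exp u)) u := by
  have h1 : (1 - u / 3) ≠ 0 := by linarith
  have hd : HasDerivAt (fun u : ℝ => 1 - u / 3) (-(1 / 3)) u :=
    ((hasDerivAt_id u).div_const 3).const_sub 1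
  have ha := (((hasDerivAt_id u).pow 2).div_const 2).div (hd.pow 2) (pow_ne_zero 2 h1)
  have hb := (((hasDerivAt_id u).mul (Real.hasDerivAt_exp u)).sub (Real.hasDerivAt_exp u)).add_const 1
  refine (ha.sub hb).congr_deriv ?_
  simp only [id, Pi.pow_apply]
  obtain ⟨v, hv⟩ : ∃ v, v = 1 - u / 3 := ⟨_, rfl⟩
  obtain rfl : u = 3 - 3 * v := by linarith
  rw [← hv] at h1 ⊢
  field_simp
  ring

/-- Both sides vanish at 0, and the derivative of the gap is u times (1 - u/3)⁻³ - e^u. The second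
factor is nonnegative since 1 - u/3 ≤ e^{-u/3}, so the gap has its minimum at 0. -/
lemma psi_le_of_lt_three {u : ℝ} (hu : u < 3) :
    u * Real.exp u - Real.exp u + 1 ≤ u ^ 2 / 2 / (1 - u / 3) ^ 2 := by
  have hfac : ∀ v : ℝ, v < 3 → 0 ≤ ((1 - v / 3) ^ 3)⁻¹ - Real.exp v := fun v hv => by
    have h1 : 0 < 1 - v / 3 := by linarith
    have h2 : 1 - v / 3 ≤ Real.exp (-(v / 3)) := by linarith [Real.add_one_le_exp (-(v / 3))]
    have h3 : (1 - v / 3) ^ 3 ≤ Real.exp (-v) := by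
      calc (1 - v / 3) ^ 3 ≤ Real.exp (-(v / 3)) ^ 3 := by gcongr
        _ = Real.exp (-v) := by rw [← Real.exp_nat_mul]; congr 1; push_cast; ring
    rw [sub_nonneg, ← inv_inv (Real.exp v), ← Real.exp_neg]
    exact inv_anti₀ (by positivity) h3
  set G := fun u : ℝ => u ^ 2 / 2 / (1 - u / 3) ^ 2 - (u * Real.exp u - Real.exp u + 1) with hG
  have hG0 : G 0 = 0 := by simp [hG]
  suffices 0 ≤ G u by simp only [hG] at this; linarith
  have hcont : ∀ v < 3, ContinuousAt G v := fun v hv => (hasDerivAt_psi_gap hv).continuousAt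
  rw [← hG0]
  rcases le_total 0 u with h | h
  · have hmono : MonotoneOn G (Set.Icc 0 u) := by
      refine monotoneOn_of_hasDerivWithinAt_nonneg (convex_Icc 0 u)
        (fun v hv => (hcont v (hv.2.trans_lt hu)).continuousWithinAt)
        (fun v hv => (hasDerivAt_psi_gap ?_).hasDerivWithinAt) fun v hv => ?_
      all_goals rw [interior_Icc] at hv
      · exact hv.2.trans hu
      · exact mul_nonneg hv.1.le (hfac v (hv.2.trans hu))
    exact hmono ⟨le_rfl, h⟩ ⟨h, le_rfl⟩ h
  · have hmono : AntitoneOn G (Set.Icc u 0) := by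
      refine antitoneOn_of_hasDerivWithinAt_nonpos (convex_Icc u 0)
        (fun v hv => (hcont v (hv.2.trans_lt three_pos)).continuousWithinAt)
        (fun v hv => (hasDerivAt_psi_gap ?_).hasDerivWithinAt) fun v hv => ?_
      all_goals rw [interior_Icc] at hv
      · exact hv.2.trans three_pos
      · exact mul_nonpos_of_nonpos_of_nonneg hv.2.le (hfac v (hv.2.trans three_pos))
    exact hmono ⟨le_rfl, h⟩ ⟨h, le_rfl⟩ h

lemma psi_le {u w : ℝ} (hu : u ≤ w) (hw : w < 3) :
    u * Real.exp u - Real.exp u + 1 ≤ u ^ 2 / 2 / (1 - w / 3) ^ 2 := by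
  refine (psi_le_of_lt_three (hu.trans_lt hw)).trans ?_
  have : 0 < 1 - w / 3 := by linarith
  gcongr

section OneDim

variable {α : Type*} [MeasurableSpace α] (ν : Measure α) [IsProbabilityMeasure ν]

/-- With E the mean of h and ψ(u) = u e^u - e^u + 1, duality (`h1`) gives Ent(e^{th}) ≤ e^{tE} ∫
ψ(t(h - E)). Then `psi_le` brings in the variance, and Jensen's inequality e^{tE} ≤ N (`hJ`) removes
the prefactor. -/
lemma entropy_le_variance {h : α → ℝ} (hh : BddMeas h) {t b : ℝ} (ht : 0 ≤ t) (htb : t * b < 3)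
    (hb : ∀ x, h x - ∫ y, h y ∂ν ≤ b) :
    ∫ x, Real.exp (t * h x) * (t * h x) ∂ν - (∫ x, Real.exp (t * h x) ∂ν)
        * Real.log (∫ x, Real.exp (t * h x) ∂ν)
      ≤ t ^ 2 / 2 / (1 - t * b / 3) ^ 2 * (∫ x, (h x - ∫ y, h y ∂ν) ^ 2 ∂ν)
        * ∫ x, Real.exp (t * h x) ∂ν := by
  have hF : BddMeas (fun x => t * h x) := hh.const_mul t
  set N := ∫ x, Real.exp (t * h x) ∂ν with hN
  set E := ∫ y, h y ∂ν with hE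
  set w := t ^ 2 / 2 / (1 - t * b / 3) ^ 2 with hw
  have hNpos : 0 < N := integral_exp_pos_of_bddMeas ν hF
  have h1 : N * (t * E) + N - Real.exp (t * E) ≤ N * Real.log N := by
    have := exp_sub_le_exp_mul (Real.log N) (t * E) one_pos
    rw [Real.exp_log hNpos] at this
    simp at this
    linarith
  have hpt : ∀ x, Real.exp (t * h x) * (t * h x) - (t * E) * Real.exp (t * h x)
      - Real.exp (t * h x) + Real.exp (t * E) ≤ Real.exp (t * E) * w * (h x - E) ^ 2 := fun x => by
    have hle : t * (h x - E) ≤ t * b := mul_le_mul_of_nonneg_left (hb x) ht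
    have := mul_le_mul_of_nonneg_left (psi_le hle htb) (Real.exp_pos (t * E)).le
    have he : Real.exp (t * h x) = Real.exp (t * E) * Real.exp (t * (h x - E)) := by
      rw [← Real.exp_add]; congr 1; ring
    calc _ = Real.exp (t * E) * (t * (h x - E) * Real.exp (t * (h x - E))
          - Real.exp (t * (h x - E)) + 1) := by rw [he]; ring
      _ ≤ _ := this
      _ = _ := by rw [hw]; ring
  have hI := integral_mono (μ := ν) (((((hF.exp.mul hF).sub (hF.exp.const_mul (t * E))).sub
    hF.exp).add (BddMeas.const (Real.exp (t * E)))).integrable ν)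
    (((hh.sub (BddMeas.const E)).sq.const_mul (Real.exp (t * E) * w)).integrable ν) hpt
  rw [integral_const_mul, integral_add ((((hF.exp.mul hF).sub (hF.exp.const_mul (t * E))).sub
    hF.exp).integrable ν) ((BddMeas.const _).integrable ν), integral_sub
    (((hF.exp.mul hF).sub (hF.exp.const_mul (t * E))).integrable ν) (hF.exp.integrable ν),
    integral_sub ((hF.exp.mul hF).integrable ν) ((hF.exp.const_mul (t * E)).integrable ν),
    integral_const_mul, ← hN] at hI
  simp only [integral_const, probReal_univ, one_smul] at hI
  have hJ : Real.exp (t * E) ≤ N := by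
    have := integral_mono (μ := ν) (((BddMeas.const (Real.exp (t * E))).mul
      ((BddMeas.const 1).add (hF.sub (BddMeas.const (t * E))))).integrable ν)
      (hF.exp.integrable ν) fun x => show _ ≤ Real.exp (t * h x) by
        have := exp_sub_le_exp_mul (t * E) (t * h x) one_pos
        simp at this
        linarith
    rw [integral_const_mul, integral_add ((BddMeas.const 1).integrable ν)
      ((hF.sub (BddMeas.const _)).integrable ν), integral_sub (hF.integrable ν)
      ((BddMeas.const _).integrable ν), integral_const_mul, ← hE] at this
    simpa using this
  have hV : 0 ≤ ∫ x, (h x - E) ^ 2 ∂ν := integral_nonneg fun x => sq_nonneg _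
  have hw0 : 0 ≤ w := by positivity
  have := mul_le_mul_of_nonneg_right hJ (mul_nonneg hw0 hV)
  linarith

lemma hasDerivAt_integral_pow_mul_exp_bddMeas {Z : α → ℝ} (hZ : BddMeas Z) (j : ℕ) (s : ℝ) :
    HasDerivAt (fun s => ∫ x, Z x ^ j * Real.exp (s * Z x) ∂ν)
      (∫ x, Z x ^ (j + 1) * Real.exp (s * Z x) ∂ν) s := by
  refine hasDerivAt_integral_pow_mul_exp_real ?_ j
  have : integrableExpSet Z ν = Set.univ :=
    Set.eq_univ_of_forall fun t => (hZ.const_mul t).exp.integrable ν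
  simp [this]

/-- Under every exponentially tilted law, a variable with values in [p², (p + d)²] has variance at
most d² times its mean. Since that variance is the derivative of the tilted mean in s, the bound
integrates to the entropy estimate. -/
lemma entropy_le_of_sqrt_range {Z : α → ℝ} (hZ : BddMeas Z) {p d t : ℝ}
    (hZl : ∀ x, p ^ 2 ≤ Z x) (hZu : ∀ x, Z x ≤ (p + d) ^ 2) (ht : 0 ≤ t) :
    ∫ x, Real.exp (t * Z x) * (t * Z x) ∂ν - (∫ x, Real.exp (t * Z x) ∂ν)
        * Real.log (∫ x, Real.exp (t * Z x) ∂ν)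
      ≤ t ^ 2 / 2 * d ^ 2 * ∫ x, Z x * Real.exp (t * Z x) ∂ν := by
  set M : ℕ → ℝ → ℝ := fun j s => ∫ x, Z x ^ j * Real.exp (s * Z x) ∂ν with hM
  have hder : ∀ j s, HasDerivAt (M j) (M (j + 1) s) s :=
    hasDerivAt_integral_pow_mul_exp_bddMeas ν hZ
  have hB : ∀ s, BddMeas (fun x => Real.exp (s * Z x)) := fun s => (hZ.const_mul s).exp
  have hM0e : ∀ s, M 0 s = ∫ x, Real.exp (s * Z x) ∂ν := fun s => by simp [hM]
  have hM1e : ∀ s, M 1 s = ∫ x, Z x * Real.exp (s * Z x) ∂ν := fun s => by simp [hM]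
  have hM2e : ∀ s, M 2 s = ∫ x, Z x ^ 2 * Real.exp (s * Z x) ∂ν := fun s => rfl
  have hM0 : ∀ s, 0 < M 0 s := fun s => by
    rw [hM0e]; exact integral_exp_pos_of_bddMeas ν (hZ.const_mul s)
  have hi0 : ∀ s, Integrable (fun x => Real.exp (s * Z x)) ν := fun s => (hB s).integrable ν
  have hi1 : ∀ s, Integrable (fun x => Z x * Real.exp (s * Z x)) ν :=
    fun s => (hZ.mul (hB s)).integrable ν
  have hi2 : ∀ s, Integrable (fun x => Z x ^ 2 * Real.exp (s * Z x)) ν :=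
    fun s => (hZ.sq.mul (hB s)).integrable ν
  have hquad : ∀ a b c s, ∫ x, (a * Z x ^ 2 + b * Z x + c) * Real.exp (s * Z x) ∂ν
      = a * M 2 s + b * M 1 s + c * M 0 s := fun a b c s => by
    rw [hM0e, hM1e, hM2e, ← integral_const_mul, ← integral_const_mul, ← integral_const_mul,
      ← integral_add ((hi2 s).const_mul a) ((hi1 s).const_mul b),
      ← integral_add ((((hZ.sq.mul (hB s)).const_mul a).add
        ((hZ.mul (hB s)).const_mul b)).integrable ν) ((hi0 s).const_mul c)]
    congr 1
    ext x
    ring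
  have hCS : ∀ s, 0 ≤ M 2 s * M 0 s - M 1 s ^ 2 := fun s => by
    have h0 : 0 ≤ ∫ x, (M 0 s ^ 2 * Z x ^ 2 + (-2 * M 0 s * M 1 s) * Z x + M 1 s ^ 2)
        * Real.exp (s * Z x) ∂ν := integral_nonneg fun x => by
      have : M 0 s ^ 2 * Z x ^ 2 + (-2 * M 0 s * M 1 s) * Z x + M 1 s ^ 2
        = (M 0 s * Z x - M 1 s) ^ 2 := by ring
      simp only [this]
      positivity
    rw [hquad] at h0
    have h1 : 0 ≤ M 0 s * (M 2 s * M 0 s - M 1 s ^ 2) := by linarith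
    exact nonneg_of_mul_nonneg_right h1 (hM0 s)
  -- Integrating (Z - p²)((p + d)² - Z) ≥ 0 gives, for the tilted mean m, variance at most (m -
  -- p²)((p + d)² - m), and this equals d² m - (m - p(p + d))².
  have hvar : ∀ s, M 2 s * M 0 s - M 1 s ^ 2 ≤ d ^ 2 * M 1 s * M 0 s := fun s => by
    have h0 : 0 ≤ ∫ x, ((-1) * Z x ^ 2 + (p ^ 2 + (p + d) ^ 2) * Z x + (-(p ^ 2 * (p + d) ^ 2)))
        * Real.exp (s * Z x) ∂ν := integral_nonneg fun x => by
      have : (-1) * Z x ^ 2 + (p ^ 2 + (p + d) ^ 2) * Z x + (-(p ^ 2 * (p + d) ^ 2))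
        = (Z x - p ^ 2) * ((p + d) ^ 2 - Z x) := by ring
      simp only [this]
      exact mul_nonneg (mul_nonneg (sub_nonneg.2 (hZl x)) (sub_nonneg.2 (hZu x)))
        (Real.exp_pos _).le
    rw [hquad] at h0
    have h1 := mul_nonneg h0 (hM0 s).le
    nlinarith [sq_nonneg (M 1 s - p * (p + d) * M 0 s)]
  -- The claim at t is `k t ≤ 0` multiplied by `M 0 t`; since `k 0 = 0`, monotonicity suffices.
  set k : ℝ → ℝ := fun s => (s - s ^ 2 / 2 * d ^ 2) * (M 1 s / M 0 s) - Real.log (M 0 s) with hk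
  have hkd : ∀ s, HasDerivAt k ((1 - s * d ^ 2) * (M 1 s / M 0 s)
      + (s - s ^ 2 / 2 * d ^ 2) * ((M 2 s * M 0 s - M 1 s * M 1 s) / M 0 s ^ 2)
      - M 1 s / M 0 s) s := fun s => by
    have h1 : HasDerivAt (fun s : ℝ => s - s ^ 2 / 2 * d ^ 2) (1 - s * d ^ 2) s := by
      refine ((hasDerivAt_id s).sub ((((hasDerivAt_id s).pow 2).div_const 2).mul_const
        (d ^ 2))).congr_deriv ?_
      simp
    exact (h1.mul ((hder 1 s).div (hder 0 s) (hM0 s).ne')).sub ((hder 0 s).log (hM0 s).ne')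
  have hanti : AntitoneOn k (Set.Ici 0) := by
    refine antitoneOn_of_hasDerivWithinAt_nonpos (convex_Ici 0)
      (fun v _ => (hkd v).continuousAt.continuousWithinAt)
      (fun v _ => (hkd v).hasDerivWithinAt) fun v hv => ?_
    rw [interior_Ici] at hv
    have hv0 : 0 < v := hv
    have e : (1 - v * d ^ 2) * (M 1 v / M 0 v)
      + (v - v ^ 2 / 2 * d ^ 2) * ((M 2 v * M 0 v - M 1 v * M 1 v) / M 0 v ^ 2)
      - M 1 v / M 0 v = -(v * (d ^ 2 * M 1 v * M 0 v - (M 2 v * M 0 v - M 1 v ^ 2))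
        + v ^ 2 / 2 * d ^ 2 * (M 2 v * M 0 v - M 1 v ^ 2)) / M 0 v ^ 2 := by
      have := (hM0 v).ne'
      field_simp
      ring
    rw [e]
    refine div_nonpos_of_nonpos_of_nonneg (neg_nonpos.2 (add_nonneg ?_ ?_)) (sq_nonneg _)
    · exact mul_nonneg hv0.le (sub_nonneg.2 (hvar v))
    · exact mul_nonneg (by positivity) (hCS v)
  have hk0 : k 0 = 0 := by simp [hk, hM0e]
  have hkt : k t ≤ 0 := hk0 ▸ hanti (Set.mem_Ici.2 le_rfl) (Set.mem_Ici.2 ht) ht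
  have h3 : ∫ x, Real.exp (t * Z x) * (t * Z x) ∂ν = t * M 1 t := by
    rw [hM1e, ← integral_const_mul]; congr 1; ext x; ring
  rw [h3, ← hM0e, ← hM1e]
  have h4 : M 0 t * k t ≤ 0 := mul_nonpos_of_nonneg_of_nonpos (hM0 t).le hkt
  have h5 : M 0 t * k t = (t - t ^ 2 / 2 * d ^ 2) * M 1 t - M 0 t * Real.log (M 0 t) := by
    have := (hM0 t).ne'
    simp only [hk]
    field_simp
  linarith

end OneDim

end IncompleteU

/-! ### Coordinate-wise variances, the Efron–Stein inequality and the regularity of √V. -/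

namespace IncompleteU

lemma sq_integral_le {α : Type*} [MeasurableSpace α] (ν : Measure α) [IsProbabilityMeasure ν]
    {h : α → ℝ} (hh : BddMeas h) : (∫ x, h x ∂ν) ^ 2 ≤ ∫ x, h x ^ 2 ∂ν := by
  set E := ∫ x, h x ∂ν with hE
  have h1 : 0 ≤ ∫ x, (h x ^ 2 - (2 * E) * h x + E ^ 2) ∂ν := integral_nonneg fun x => by
    simp only [Pi.zero_apply]; nlinarith [sq_nonneg (h x - E)]
  rw [integral_add ((hh.sq.sub (hh.const_mul _)).integrable ν) ((BddMeas.const _).integrable ν),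
    integral_sub (hh.sq.integrable ν) ((hh.const_mul _).integrable ν), integral_const_mul,
    ← hE] at h1
  simp only [integral_const, probReal_univ, one_smul] at h1
  linarith

lemma half_integral_sub_sq {α : Type*} [MeasurableSpace α] (ν : Measure α)
    [IsProbabilityMeasure ν] {h : α → ℝ} (hh : BddMeas h) :
    1 / 2 * ∫ z : α × α, (h z.1 - h z.2) ^ 2 ∂(ν.prod ν) = ∫ x, h x ^ 2 ∂ν - (∫ x, h x ∂ν) ^ 2 := by
  have h1 := hh.comp (measurable_fst (α := α) (β := α))
  have h2 := hh.comp (measurable_snd (α := α) (β := α))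
  have e1 : ∫ z : α × α, h z.1 ^ 2 ∂(ν.prod ν) = ∫ x, h x ^ 2 ∂ν := by
    rw [integral_fun_fst (fun x => h x ^ 2)]; simp
  have e2 : ∫ z : α × α, h z.2 ^ 2 ∂(ν.prod ν) = ∫ x, h x ^ 2 ∂ν := by
    rw [integral_fun_snd (fun x => h x ^ 2)]; simp
  have e3 : ∫ z : α × α, h z.1 * h z.2 ∂(ν.prod ν) = (∫ x, h x ∂ν) ^ 2 := by
    rw [integral_prod_mul, sq]
  have : ∀ z : α × α, (h z.1 - h z.2) ^ 2 = h z.1 ^ 2 + h z.2 ^ 2 - 2 * (h z.1 * h z.2) :=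
    fun z => by ring
  simp_rw [this]
  rw [integral_sub ((h1.sq.add h2.sq).integrable _) (((h1.mul h2).const_mul 2).integrable _),
    integral_add (h1.sq.integrable _) (h2.sq.integrable _), integral_const_mul, e1, e2, e3]
  ring

lemma integral_sub_integral_sq {α : Type*} [MeasurableSpace α] (ν : Measure α)
    [IsProbabilityMeasure ν] {h : α → ℝ} (hh : BddMeas h) :
    ∫ x, (h x - ∫ y, h y ∂ν) ^ 2 ∂ν = ∫ x, h x ^ 2 ∂ν - (∫ x, h x ∂ν) ^ 2 := by
  set E := ∫ x, h x ∂ν with hE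
  have : ∀ x, (h x - E) ^ 2 = h x ^ 2 - (2 * E) * h x + E ^ 2 := fun x => by ring
  simp_rw [this]
  rw [integral_add ((hh.sq.sub (hh.const_mul _)).integrable ν) ((BddMeas.const _).integrable ν),
    integral_sub (hh.sq.integrable ν) ((hh.const_mul _).integrable ν), integral_const_mul, ← hE]
  simp only [integral_const, probReal_univ, one_smul]
  ring

variable {𝒳 : Type*} [MeasurableSpace 𝒳] {n : ℕ} (μ : Measure 𝒳) [IsProbabilityMeasure μ]

/-- The variance of `f` with respect to its `k`-th argument, the other arguments being fixed. -/
noncomputable def varCoord (k : Fin n) (f : (Fin n → 𝒳) → ℝ) (x : Fin n → 𝒳) : ℝ :=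
  1 / 2 * ∫ z : 𝒳 × 𝒳, D k z.1 z.2 f x ^ 2 ∂(μ.prod μ)

/-- The sum of the coordinate-wise conditional variances. -/
noncomputable def varSum (f : (Fin n → 𝒳) → ℝ) (x : Fin n → 𝒳) : ℝ := ∑ k, varCoord μ k f x

variable {μ} {f g : (Fin n → 𝒳) → ℝ}

lemma BddMeas.D_prod (hf : BddMeas f) (k : Fin n) :
    BddMeas (fun p : (Fin n → 𝒳) × (𝒳 × 𝒳) => D k p.2.1 p.2.2 f p.1) :=
  ((hf.update_prod k).comp (measurable_fst.prodMk (measurable_fst.comp measurable_snd))).sub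
    ((hf.update_prod k).comp (measurable_fst.prodMk (measurable_snd.comp measurable_snd)))

lemma BddMeas.D (hf : BddMeas f) (k : Fin n) (y y' : 𝒳) : BddMeas (D k y y' f) :=
  (hf.D_prod k).comp (φ := fun x => (x, (y, y'))) (measurable_id.prodMk measurable_const)

lemma BddMeas.D_right (hf : BddMeas f) (k : Fin n) (x : Fin n → 𝒳) :
    BddMeas (fun z : 𝒳 × 𝒳 => IncompleteU.D k z.1 z.2 f x) :=
  (hf.D_prod k).comp (measurable_const.prodMk measurable_id)

lemma BddMeas.varCoord (hf : BddMeas f) (k : Fin n) : BddMeas (varCoord μ k f) :=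
  ((hf.D_prod k).sq.integral_right (μ.prod μ)).const_mul _

lemma BddMeas.varSum (hf : BddMeas f) : BddMeas (varSum μ f) :=
  BddMeas.sum _ fun k _ => hf.varCoord k

lemma varCoord_nonneg (k : Fin n) (f : (Fin n → 𝒳) → ℝ) (x : Fin n → 𝒳) :
    0 ≤ varCoord μ k f x :=
  mul_nonneg (by norm_num) (integral_nonneg fun _ => sq_nonneg _)

lemma varSum_nonneg (f : (Fin n → 𝒳) → ℝ) (x : Fin n → 𝒳) : 0 ≤ varSum μ f x :=
  Finset.sum_nonneg fun k _ => varCoord_nonneg k f x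

@[simp] lemma D_update_self (k : Fin n) (y y' y'' : 𝒳) (f : (Fin n → 𝒳) → ℝ) (x : Fin n → 𝒳) :
    D k y y' f (Function.update x k y'') = D k y y' f x := by
  simp [D]

@[simp] lemma varCoord_update_self (k : Fin n) (f : (Fin n → 𝒳) → ℝ) (x : Fin n → 𝒳) (y : 𝒳) :
    varCoord μ k f (Function.update x k y) = varCoord μ k f x := by
  simp [varCoord]

lemma varCoord_eq (hf : BddMeas f) (k : Fin n) (x : Fin n → 𝒳) :
    varCoord μ k f x = ∫ y, (f (Function.update x k y) - avg μ k f x) ^ 2 ∂μ := by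
  rw [avg, integral_sub_integral_sq μ (hf.update k x), ← half_integral_sub_sq μ (hf.update k x)]
  rfl

lemma integral_varCoord (hf : BddMeas f) (k : Fin n) :
    ∫ x, varCoord μ k f x ∂(Measure.pi fun _ => μ)
      = ∫ x, (f x - avg μ k f x) ^ 2 ∂(Measure.pi fun _ => μ) := by
  rw [← integral_avg (hf.sub (hf.avg k)).sq k]
  congr 1
  ext x
  rw [varCoord_eq hf]
  conv_rhs => rw [avg]
  simp_rw [avg_update]

lemma integral_varCoord_eq_sub (hf : BddMeas f) (k : Fin n) :
    ∫ x, varCoord μ k f x ∂(Measure.pi fun _ => μ)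
      = ∫ x, f x ^ 2 ∂(Measure.pi fun _ => μ) - ∫ x, avg μ k f x ^ 2 ∂(Measure.pi fun _ => μ) := by
  rw [← integral_avg hf.sq k, ← integral_sub ((hf.sq.avg k).integrable _)
    ((hf.avg k).sq.integrable _)]
  congr 1
  ext x
  rw [varCoord_eq hf, avg, integral_sub_integral_sq μ (hf.update k x)]
  rfl

lemma avg_comm (hf : BddMeas f) (j k : Fin n) (x : Fin n → 𝒳) :
    avg μ k (avg μ j f) x = avg μ j (avg μ k f) x := by
  by_cases h : j = k
  · rw [h]
  · simp only [avg]
    rw [integral_integral_swap]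
    · simp_rw [Function.update_comm h]
    · exact BddMeas.integrable (hf.comp ((measurable_update_prod j).comp
        (((measurable_update x).comp measurable_fst).prodMk measurable_snd))) _

/-- Averaging over j commutes with centering in k, and Jensen's inequality shows that it contracts
the L² norm. -/
lemma integral_varCoord_avg_le (hf : BddMeas f) (j k : Fin n) :
    ∫ x, varCoord μ k (avg μ j f) x ∂(Measure.pi fun _ => μ)
      ≤ ∫ x, varCoord μ k f x ∂(Measure.pi fun _ => μ) := by
  rw [integral_varCoord (hf.avg j), integral_varCoord hf,
    ← integral_avg (hf.sub (hf.avg k)).sq j]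
  refine integral_mono (((hf.avg j).sub ((hf.avg j).avg k)).sq.integrable _)
    (((hf.sub (hf.avg k)).sq.avg j).integrable _) fun x => ?_
  simp only
  rw [avg_comm hf, ← avg_sub hf (hf.avg k)]
  exact sq_integral_le μ ((hf.sub (hf.avg k)).update j x)

lemma integral_varCoord_avgList_le (hf : BddMeas f) (l : List (Fin n)) (k : Fin n) :
    ∫ x, varCoord μ k (avgList μ l f) x ∂(Measure.pi fun _ => μ)
      ≤ ∫ x, varCoord μ k f x ∂(Measure.pi fun _ => μ) := by
  induction l with
  | nil => rfl
  | cons j l ih => exact (integral_varCoord_avg_le (hf.avgList l) j k).trans ih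

/-- The Efron–Stein inequality. -/
theorem integral_sq_le_efronStein (hf : BddMeas f) :
    ∫ x, f x ^ 2 ∂(Measure.pi fun _ => μ) ≤ (∫ x, f x ∂(Measure.pi fun _ => μ)) ^ 2
      + ∑ k, ∫ x, varCoord μ k f x ∂(Measure.pi fun _ => μ) := by
  -- Averaging out one more coordinate lowers the second moment by the variance in that coordinate
  -- of a partial average, which is at most the corresponding variance of f itself.
  have key : ∀ l : List (Fin n), ∫ x, f x ^ 2 ∂(Measure.pi fun _ => μ)
      ≤ ∫ x, avgList μ l f x ^ 2 ∂(Measure.pi fun _ => μ)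
        + (l.map fun k => ∫ x, varCoord μ k f x ∂(Measure.pi fun _ => μ)).sum := by
    intro l
    induction l with
    | nil => simp
    | cons k l ih =>
      have h1 := integral_varCoord_eq_sub (μ := μ) (hf.avgList (μ := μ) l) k
      have h2 := integral_varCoord_avgList_le (μ := μ) hf l k
      rw [List.map_cons, List.sum_cons, avgList_cons]
      linarith
  have := key (Finset.univ : Finset (Fin n)).toList
  rw [Finset.sum_map_toList] at this
  simp_rw [avgList_univ hf (l := (Finset.univ : Finset (Fin n)).toList) (by simp)] at this
  simpa using this

/-- Turns a one-variable entropy estimate, valid for all frozen values of the other coordinates,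
into a bound on a summand of `entropy_le_sum`. -/
lemma integral_entropy_le_of_avg_le {F G : (Fin n → 𝒳) → ℝ} (hF : BddMeas F) (hG : BddMeas G)
    (k : Fin n) (h : ∀ x, avg μ k (fun x => Real.exp (F x) * F x) x
      - avg μ k (fun x => Real.exp (F x)) x * Real.log (avg μ k (fun x => Real.exp (F x)) x)
      ≤ avg μ k G x) :
    ∫ x, Real.exp (F x) * (F x - Real.log (avg μ k (fun x => Real.exp (F x)) x))
      ∂(Measure.pi fun _ => μ) ≤ ∫ x, G x ∂(Measure.pi fun _ => μ) := by
  have hL := bddMeas_log_avg_exp (μ := μ) hF k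
  rw [← integral_avg (hF.exp.mul (hF.sub hL)) k, ← integral_avg hG k]
  refine integral_mono (((hF.exp.mul (hF.sub hL)).avg k).integrable _)
    ((hG.avg k).integrable _) fun x => ?_
  refine le_trans (le_of_eq ?_) (h x)
  simp_rw [mul_sub]
  rw [avg_sub (hF.exp.mul hF) (hF.exp.mul hL), mul_comm (avg μ k _ x),
    ← avg_mul_left (g := fun x => Real.log (avg μ k (fun x => Real.exp (F x)) x))
      (fun x y => by rw [avg_update])]
  simp_rw [mul_comm (Real.exp _)]

/-- Minkowski's inequality recovered from its Young form, which can be summed and integrated term by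
term. The optimal s is d / √b; adding ε/2 to both √b and d keeps the quotient meaningful when one of
them vanishes. -/
lemma sqrt_le_sqrt_add {a b d : ℝ} (ha : 0 ≤ a) (hb : 0 ≤ b) (hd : 0 ≤ d)
    (h : ∀ s, 0 < s → a ≤ (1 + s) * b + (1 + 1 / s) * d ^ 2) : √a ≤ √b + d := by
  by_contra! hlt
  set ε := √a - (√b + d) with hε
  have hεpos : 0 < ε := by linarith
  have hb0 := Real.sqrt_nonneg b
  set B := √b + ε / 2 with hB
  set C := d + ε / 2 with hC
  have hBpos : 0 < B := by positivity
  have hCpos : 0 < C := by positivity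
  have h1 := h (C / B) (div_pos hCpos hBpos)
  have h2 : b < B ^ 2 := by
    nlinarith [Real.sq_sqrt hb]
  have h3 : d ^ 2 ≤ C ^ 2 := by nlinarith
  have h4 : (1 + C / B) * B ^ 2 + (1 + 1 / (C / B)) * C ^ 2 = a := by
    rw [← Real.sq_sqrt ha, show √a = B + C by rw [hB, hC, hε]; ring]
    field_simp
    ring
  have h5 : (1 + C / B) * b < (1 + C / B) * B ^ 2 := by gcongr
  have h6 : (1 + 1 / (C / B)) * d ^ 2 ≤ (1 + 1 / (C / B)) * C ^ 2 := by gcongr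
  linarith

/-- The square root of the sum of conditional variances varies in its `l`-th argument at most as
much as the mixed second differences allow. -/
lemma sqrt_varSum_update_le (hf : BddMeas f) {l : Fin n} {d : ℝ} (hd0 : 0 ≤ d)
    {x : Fin n → 𝒳} {y y' : 𝒳}
    (hd : ∑ k ∈ Finset.univ.filter (fun k => l ≠ k),
      1 / 2 * ∫ z : 𝒳 × 𝒳, D l y y' (D k z.1 z.2 f) x ^ 2 ∂(μ.prod μ) ≤ d ^ 2) :
    √(varSum μ f (Function.update x l y)) ≤ √(varSum μ f (Function.update x l y')) + d := by
  refine sqrt_le_sqrt_add (varSum_nonneg _ _) (varSum_nonneg _ _) hd0 fun s hs => ?_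
  have hk : ∀ k, l ≠ k → varCoord μ k f (Function.update x l y)
      ≤ (1 + s) * varCoord μ k f (Function.update x l y') + (1 + 1 / s) *
        (1 / 2 * ∫ z : 𝒳 × 𝒳, D l y y' (D k z.1 z.2 f) x ^ 2 ∂(μ.prod μ)) := fun k _ => by
    have h1 := hf.D_right k (Function.update x l y)
    have h2 := hf.D_right k (Function.update x l y')
    have := integral_mono (μ := μ.prod μ) (h1.sq.integrable _)
      (((h2.sq.const_mul (1 + s)).add ((h1.sub h2).sq.const_mul (1 + 1 / s))).integrable _)
      fun z => by
        simp only
        set u := D k z.1 z.2 f (Function.update x l y)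
        set v := D k z.1 z.2 f (Function.update x l y')
        have e : (1 + s) * v ^ 2 + (1 + 1 / s) * (u - v) ^ 2 - u ^ 2
          = (s * v - (u - v)) ^ 2 / s := by field_simp; ring
        have : 0 ≤ (s * v - (u - v)) ^ 2 / s := by positivity
        linarith
    rw [integral_add ((h2.sq.const_mul (1 + s)).integrable _)
      (((h1.sub h2).sq.const_mul (1 + 1 / s)).integrable _), integral_const_mul,
      integral_const_mul] at this
    change _ ≤ _ * _ + _ * ∫ z : 𝒳 × 𝒳, D l y y' (D k z.1 z.2 f) x ^ 2 ∂(μ.prod μ) at this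
    simp only [varCoord]
    linarith
  have hsplit : ∀ x', varSum μ f x' = varCoord μ l f x'
      + ∑ k ∈ Finset.univ.filter (fun k => l ≠ k), varCoord μ k f x' := fun x' => by
    rw [varSum, ← Finset.add_sum_erase _ _ (Finset.mem_univ l)]
    congr 2
    ext k
    simp [eq_comm]
  have hsum := Finset.sum_le_sum fun k (hk' : k ∈ Finset.univ.filter (fun k => l ≠ k)) =>
    hk k (Finset.mem_filter.1 hk').2
  rw [Finset.sum_add_distrib, ← Finset.mul_sum, ← Finset.mul_sum] at hsum
  have hmul := mul_le_mul_of_nonneg_left hd (show 0 ≤ 1 + 1 / s by positivity)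
  have hl := varCoord_nonneg (μ := μ) l f x
  -- The l-th conditional variance does not depend on the l-th argument, so only the terms with k ≠
  -- l contribute a difference.
  rw [hsplit, hsplit, varCoord_update_self, varCoord_update_self]
  nlinarith

end IncompleteU

/-! ### From entropy to exponential moments and a Bernstein inequality. -/

namespace IncompleteU

/-- Integration of the entropy differential inequality. -/
lemma le_mul_of_entropy_le {L L' H H' : ℝ → ℝ} {t : ℝ} (ht : 0 < t)
    (hL : ∀ s ∈ Set.Icc 0 t, HasDerivAt L (L' s) s) (hH : ∀ s ∈ Set.Icc 0 t, HasDerivAt H (H' s) s)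
    (hL0 : L 0 = 0) (hH0 : H 0 = 0)
    (h : ∀ s ∈ Set.Ioo 0 t, s * L' s - L s ≤ s ^ 2 * H' s) : L t ≤ t * (L' 0 + H t) := by
  -- Herbst's argument: (L/s)' = (s L' - L)/s² is at most H', and L/s tends to L'(0) as s decreases
  -- to 0.
  have hd : ∀ s ∈ Set.Ioc 0 t, HasDerivAt (fun s => L s / s - H s)
      ((L' s * s - L s * 1) / s ^ 2 - H' s) s := fun s hs =>
    ((hL s ⟨hs.1.le, hs.2⟩).div (hasDerivAt_id s) hs.1.ne').sub (hH s ⟨hs.1.le, hs.2⟩)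
  have hanti : AntitoneOn (fun s => L s / s - H s) (Set.Ioc 0 t) := by
    refine antitoneOn_of_hasDerivWithinAt_nonpos (convex_Ioc 0 t)
      (fun s hs => (hd s hs).continuousAt.continuousWithinAt)
      (f' := fun s => (L' s * s - L s * 1) / s ^ 2 - H' s) (fun s hs => ?_) fun s hs => ?_
    all_goals rw [interior_Ioc] at hs
    · exact (hd s ⟨hs.1, hs.2.le⟩).hasDerivWithinAt
    · rw [sub_nonpos, div_le_iff₀ (pow_pos hs.1 2)]
      linarith [h s hs]
  have hlim : Filter.Tendsto (fun s => L s / s - H s) (nhdsWithin 0 (Set.Ioi 0))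
      (nhds (L' 0 - 0)) := by
    refine Filter.Tendsto.sub ?_ ?_
    · have := (hL 0 ⟨le_rfl, ht.le⟩).tendsto_slope
      refine (this.mono_left (nhdsWithin_mono _ fun s hs => ne_of_gt hs)).congr fun s => ?_
      simp [slope, hL0, div_eq_inv_mul]
    · have := (hH 0 ⟨le_rfl, ht.le⟩).continuousAt.tendsto
      rw [hH0] at this
      exact this.mono_left nhdsWithin_le_nhds
  have hle : L t / t - H t ≤ L' 0 - 0 := by
    refine ge_of_tendsto hlim ?_
    filter_upwards [Ioo_mem_nhdsGT ht] with s hs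
    exact hanti ⟨hs.1, hs.2.le⟩ ⟨ht, le_rfl⟩ hs.2.le
  have h2 : L t / t ≤ L' 0 + H t := by linarith
  rw [div_le_iff₀ ht] at h2
  linarith

lemma hasDerivAt_log_mgf {α : Type*} [MeasurableSpace α] (ν : Measure α) [IsProbabilityMeasure ν]
    {Z : α → ℝ} (hZ : BddMeas Z) (s : ℝ) :
    HasDerivAt (fun s => Real.log (∫ x, Real.exp (s * Z x) ∂ν))
      ((∫ x, Z x * Real.exp (s * Z x) ∂ν) / ∫ x, Real.exp (s * Z x) ∂ν) s := by
  have h := hasDerivAt_integral_pow_mul_exp_bddMeas ν hZ 0 s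
  simp only [pow_zero, one_mul, zero_add, pow_one] at h
  exact h.log (integral_exp_pos_of_bddMeas ν (hZ.const_mul s)).ne'

variable {𝒳 : Type*} [MeasurableSpace 𝒳] {n : ℕ} {μ : Measure 𝒳} [IsProbabilityMeasure μ]
  {f : (Fin n → 𝒳) → ℝ}

/-- `d l` bounds the interaction of the `l`-th argument of `f` with all the other arguments. -/
def InteractionBound (μ : Measure 𝒳) (f : (Fin n → 𝒳) → ℝ) (d : Fin n → ℝ) : Prop :=
  ∀ l, 0 ≤ d l ∧ ∀ x y y', ∑ k ∈ Finset.univ.filter (fun k => l ≠ k),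
    1 / 2 * ∫ z : 𝒳 × 𝒳, D l y y' (D k z.1 z.2 f) x ^ 2 ∂(μ.prod μ) ≤ d l ^ 2

/-- As the l-th argument varies, √V stays within d_l of its infimum p, so in each coordinate V takes
values in [p², (p + d_l)²] and `entropy_le_of_sqrt_range` applies. -/
lemma entropy_varSum_le (hf : BddMeas f) {d : Fin n → ℝ} (hd : InteractionBound μ f d) {t : ℝ}
    (ht : 0 ≤ t) :
    ∫ x, Real.exp (t * varSum μ f x) * (t * varSum μ f x) ∂(Measure.pi fun _ => μ)
        - (∫ x, Real.exp (t * varSum μ f x) ∂(Measure.pi fun _ => μ))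
          * Real.log (∫ x, Real.exp (t * varSum μ f x) ∂(Measure.pi fun _ => μ))
      ≤ t ^ 2 / 2 * (∑ l, d l ^ 2)
        * ∫ x, varSum μ f x * Real.exp (t * varSum μ f x) ∂(Measure.pi fun _ => μ) := by
  have hg : BddMeas (varSum μ f) := hf.varSum
  have hF := hg.const_mul t
  have : Nonempty 𝒳 := nonempty_of_isProbabilityMeasure μ
  refine (entropy_le_sum hF).trans ?_
  rw [Finset.mul_sum, Finset.sum_mul]
  refine Finset.sum_le_sum fun l _ => ?_
  rw [← integral_const_mul]
  refine integral_entropy_le_of_avg_le hF ((hg.mul hF.exp).const_mul _) l fun x => ?_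
  set Z : 𝒳 → ℝ := fun y => varSum μ f (Function.update x l y) with hZ
  have hZ0 : ∀ y, 0 ≤ Z y := fun y => varSum_nonneg _ _
  have hbdd : BddBelow (Set.range fun y => √(Z y)) :=
    ⟨0, by rintro _ ⟨y, rfl⟩; exact Real.sqrt_nonneg _⟩
  have hp0 : 0 ≤ ⨅ y, √(Z y) := Real.iInf_nonneg fun y => Real.sqrt_nonneg _
  have := entropy_le_of_sqrt_range μ (Z := Z) (p := ⨅ y, √(Z y)) (d := d l) (t := t)
    (hg.update l x) (fun y => ?_) (fun y => ?_) ht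
  · refine this.trans (le_of_eq ?_)
    rw [← integral_const_mul]
    rfl
  · rw [← Real.sq_sqrt (hZ0 y)]
    exact pow_le_pow_left₀ hp0 (ciInf_le hbdd y) 2
  · rw [← Real.sq_sqrt (hZ0 y)]
    refine pow_le_pow_left₀ (Real.sqrt_nonneg _) ?_ 2
    rw [← sub_le_iff_le_add]
    refine le_ciInf fun y' => ?_
    rw [sub_le_iff_le_add]
    exact sqrt_varSum_update_le hf (hd l).1 ((hd l).2 x y y')

/-- The entropy bound for V is proportional to the derivative of L, its log-moment generating
function, so Herbst's argument runs with H = (a/2) L and yields an inequality linear in L(t). -/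
lemma log_mgf_varSum_le (hf : BddMeas f) {d : Fin n → ℝ} (hd : InteractionBound μ f d) {t a : ℝ}
    (ht : 0 < t) (ha : ∑ l, d l ^ 2 ≤ a) :
    Real.log (∫ x, Real.exp (t * varSum μ f x) ∂(Measure.pi fun _ => μ)) * (1 - a * t / 2)
      ≤ t * ∫ x, varSum μ f x ∂(Measure.pi fun _ => μ) := by
  have hg : BddMeas (varSum μ f) := hf.varSum
  set ν := (Measure.pi fun _ : Fin n => μ)
  have hL := hasDerivAt_log_mgf ν hg
  set L : ℝ → ℝ := fun s => Real.log (∫ x, Real.exp (s * varSum μ f x) ∂ν) with hLdef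
  have key := le_mul_of_entropy_le (L := L) (H := fun s => a / 2 * L s) ht (fun s _ => hL s)
    (fun s _ => (hL s).const_mul (a / 2)) (by simp [hLdef]) (by simp [hLdef]) fun s hs => ?_
  · simp only [zero_mul, Real.exp_zero, mul_one, integral_const, probReal_univ, smul_eq_mul,
      div_one] at key
    change L t * _ ≤ _
    linarith
  · have hN : 0 < ∫ x, Real.exp (s * varSum μ f x) ∂ν := integral_exp_pos_of_bddMeas ν (hg.const_mul s)
    have h1 := entropy_varSum_le hf hd hs.1.le
    have hM : 0 ≤ ∫ x, varSum μ f x * Real.exp (s * varSum μ f x) ∂ν :=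
      integral_nonneg fun x => mul_nonneg (varSum_nonneg _ _) (Real.exp_pos _).le
    have h2 : ∫ x, Real.exp (s * varSum μ f x) * (s * varSum μ f x) ∂ν
        = s * ∫ x, varSum μ f x * Real.exp (s * varSum μ f x) ∂ν := by
      rw [← integral_const_mul]; congr 1; ext x; ring
    have h3 : s ^ 2 / 2 * (∑ l, d l ^ 2) * ∫ x, varSum μ f x * Real.exp (s * varSum μ f x) ∂ν
        ≤ s ^ 2 / 2 * a * ∫ x, varSum μ f x * Real.exp (s * varSum μ f x) ∂ν := by gcongr
    rw [h2] at h1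
    have h4 := h1.trans h3
    simp only [hLdef]
    rw [← sub_nonneg] at h4 ⊢
    have h5 := div_nonneg h4 hN.le
    simp only [show (Measure.pi fun _ : Fin n => μ) = ν from rfl] at h5
    refine h5.trans (le_of_eq ?_)
    field_simp

lemma entropy_le_varSum (hf : BddMeas f) {b s : ℝ} (hb : ∀ k x, f x - avg μ k f x ≤ b)
    (hs : 0 ≤ s) (hsb : s * b < 3) :
    ∫ x, Real.exp (s * f x) * (s * f x) ∂(Measure.pi fun _ => μ)
        - (∫ x, Real.exp (s * f x) ∂(Measure.pi fun _ => μ))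
          * Real.log (∫ x, Real.exp (s * f x) ∂(Measure.pi fun _ => μ))
      ≤ s ^ 2 / 2 / (1 - s * b / 3) ^ 2
        * ∫ x, Real.exp (s * f x) * varSum μ f x ∂(Measure.pi fun _ => μ) := by
  have hF := hf.const_mul s
  refine (entropy_le_sum hF).trans ?_
  rw [← integral_const_mul]
  have hG : ∀ k, BddMeas (fun x => s ^ 2 / 2 / (1 - s * b / 3) ^ 2
      * (varCoord μ k f x * Real.exp (s * f x))) :=
    fun k => ((hf.varCoord k).mul hF.exp).const_mul _
  have : ∀ x, s ^ 2 / 2 / (1 - s * b / 3) ^ 2 * (Real.exp (s * f x) * varSum μ f x)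
      = ∑ k, s ^ 2 / 2 / (1 - s * b / 3) ^ 2 * (varCoord μ k f x * Real.exp (s * f x)) := fun x => by
    rw [varSum, Finset.mul_sum, Finset.mul_sum]
    exact Finset.sum_congr rfl fun k _ => by ring
  simp_rw [this]
  rw [integral_finsetSum _ fun k _ => (hG k).integrable _]
  refine Finset.sum_le_sum fun k _ => integral_entropy_le_of_avg_le hF (hG k) k fun x => ?_
  refine (entropy_le_variance μ (hf.update k x) hs hsb fun y => ?_).trans (le_of_eq ?_)
  · have := hb k (Function.update x k y)
    rwa [avg_update] at this
  · have e : ∀ x, s ^ 2 / 2 / (1 - s * b / 3) ^ 2 * (varCoord μ k f x * Real.exp (s * f x))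
        = (s ^ 2 / 2 / (1 - s * b / 3) ^ 2 * varCoord μ k f x) * Real.exp (s * f x) :=
      fun x => by ring
    simp_rw [e]
    rw [avg_mul_left (fun x y => by rw [varCoord_update_self]), varCoord_eq hf]
    rfl

lemma entropy_le_bernstein (hf : BddMeas f) {d : Fin n → ℝ} (hd : InteractionBound μ f d)
    {b j v s : ℝ} (hj : 0 < j) (hdj : ∑ l, d l ^ 2 ≤ j ^ 2)
    (hb : ∀ k x, f x - avg μ k f x ≤ b)
    (hv : ∫ x, varSum μ f x ∂(Measure.pi fun _ => μ) ≤ v) (hs : 0 < s)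
    (hsc : (b / 3 + j / 2) * s < 1) :
    ∫ x, Real.exp (s * f x) * (s * f x) ∂(Measure.pi fun _ => μ)
        - (∫ x, Real.exp (s * f x) ∂(Measure.pi fun _ => μ))
          * Real.log (∫ x, Real.exp (s * f x) ∂(Measure.pi fun _ => μ))
      ≤ s ^ 2 * (v / 2 / (1 - (b / 3 + j / 2) * s) ^ 2)
        * ∫ x, Real.exp (s * f x) ∂(Measure.pi fun _ => μ) := by
  have hr : 0 < 1 - s * b / 3 := by nlinarith [mul_pos hj hs]
  set r := 1 - s * b / 3 with hrdef
  have h1 := entropy_le_varSum (μ := μ) hf hb hs.le (by linarith)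
  have hF := hf.const_mul s
  -- With τ = sj/(2r), this θ satisfies both j²θ/2 = τ and τθ = s²/(2r²). The same τ < 1 is thus the
  -- coefficient of Ent after decoupling and the loss in the exponential moment of V, and the two
  -- combine into (1 - τ)².
  set θ := s / (r * j) with hθ
  have hθpos : 0 < θ := by positivity
  have h2 := integral_exp_mul_le (Measure.pi fun _ : Fin n => μ) hF
    ((hf.varSum (μ := μ)).const_mul θ)
  have h3 := log_mgf_varSum_le hf hd hθpos hdj
  set ν := (Measure.pi fun _ : Fin n => μ)
  set N := ∫ x, Real.exp (s * f x) ∂ν with hN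
  have hNpos : 0 < N := integral_exp_pos_of_bddMeas ν hF
  set Ent := ∫ x, Real.exp (s * f x) * (s * f x) ∂ν - N * Real.log N with hEnt
  set I := ∫ x, Real.exp (s * f x) * varSum μ f x ∂ν with hI
  set L := Real.log (∫ x, Real.exp (θ * varSum μ f x) ∂ν) with hL
  have h4 : ∫ x, Real.exp (s * f x) * (θ * varSum μ f x) ∂ν = θ * I := by
    rw [hI, ← integral_const_mul]; congr 1; ext x; ring
  rw [h4] at h2
  set τ := s * j / (2 * r) with hτ
  have hτ0 : 0 ≤ τ := by positivity
  have hr1 : r * (1 - τ) = 1 - (b / 3 + j / 2) * s := by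
    rw [hτ]; field_simp; rw [hrdef]; ring
  have hτ1 : 0 < 1 - τ := pos_of_mul_pos_right (by rw [hr1]; linarith) hr.le
  have e1 : j ^ 2 * θ / 2 = τ := by rw [hθ, hτ]; field_simp
  have e2 : s ^ 2 / 2 / r ^ 2 = τ * θ := by rw [hθ, hτ]; field_simp
  rw [e1] at h3
  rw [e2] at h1
  -- The entropy reappears on the right with coefficient τ and is absorbed on the left.
  have h5 : Ent ≤ τ * (Ent + N * L) := by
    have := mul_le_mul_of_nonneg_left h2 hτ0
    linarith
  have h6 : Ent * (1 - τ) ^ 2 ≤ τ * N * (θ * v) := by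
    have a1 : (Ent * (1 - τ)) * (1 - τ) ≤ (τ * N * L) * (1 - τ) :=
      mul_le_mul_of_nonneg_right (by linarith) hτ1.le
    have a2 : τ * N * (L * (1 - τ)) ≤ τ * N * (θ * v) :=
      mul_le_mul_of_nonneg_left (h3.trans (mul_le_mul_of_nonneg_left hv hθpos.le)) (by positivity)
    linarith
  have h7 : Ent ≤ τ * N * (θ * v) / (1 - τ) ^ 2 := by rwa [le_div_iff₀ (by positivity)]
  refine h7.trans (le_of_eq ?_)
  rw [← hr1]
  have : τ * N * (θ * v) / (1 - τ) ^ 2 = (τ * θ) * (N * v) / (1 - τ) ^ 2 := by ring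
  rw [this, ← e2]
  field_simp

lemma log_mgf_le_bernstein (hf : BddMeas f) {d : Fin n → ℝ} (hd : InteractionBound μ f d)
    {b j v s : ℝ} (hb0 : 0 < b) (hj : 0 < j) (hdj : ∑ l, d l ^ 2 ≤ j ^ 2)
    (hb : ∀ k x, f x - avg μ k f x ≤ b)
    (hv : ∫ x, varSum μ f x ∂(Measure.pi fun _ => μ) ≤ v) (hs : 0 < s)
    (hsc : (b / 3 + j / 2) * s < 1) :
    Real.log (∫ x, Real.exp (s * f x) ∂(Measure.pi fun _ => μ))
      ≤ s * (∫ x, f x ∂(Measure.pi fun _ => μ) + v / 2 * (s / (1 - (b / 3 + j / 2) * s))) := by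
  set c := b / 3 + j / 2 with hc
  have hc0 : 0 < c := by positivity
  set ν := (Measure.pi fun _ : Fin n => μ)
  have hlt : ∀ u ∈ Set.Icc 0 s, 0 < 1 - c * u := fun u hu => by nlinarith [hu.1, hu.2]
  have key := le_mul_of_entropy_le (L := fun s => Real.log (∫ x, Real.exp (s * f x) ∂ν))
    (H := fun s => v / 2 * (s / (1 - c * s)))
    (H' := fun s => v / 2 / (1 - c * s) ^ 2) hs (fun u _ => hasDerivAt_log_mgf ν hf u)
    (fun u hu => ?_) (by simp) (by simp) fun u hu => ?_
  · simpa using key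
  · have hne := (hlt u hu).ne'
    refine (((hasDerivAt_id u).div (((hasDerivAt_id u).const_mul c).const_sub 1) hne).const_mul
      (v / 2)).congr_deriv ?_
    simp only [id]
    field_simp
    ring
  · have h1 := entropy_le_bernstein hf hd hj hdj hb hv hu.1
      (by rw [← hc]; linarith [hlt u ⟨hu.1.le, hu.2.le⟩])
    have hN : 0 < ∫ x, Real.exp (u * f x) ∂ν := integral_exp_pos_of_bddMeas ν (hf.const_mul u)
    have h2 : ∫ x, Real.exp (u * f x) * (u * f x) ∂ν = u * ∫ x, f x * Real.exp (u * f x) ∂ν := by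
      rw [← integral_const_mul]; congr 1; ext x; ring
    rw [h2] at h1
    simp only [show (Measure.pi fun _ : Fin n => μ) = ν from rfl] at h1
    have h3 := div_le_div_of_nonneg_right h1 hN.le
    rw [mul_div_cancel_right₀ _ hN.ne'] at h3
    refine le_trans (le_of_eq ?_) h3
    field_simp

lemma measureReal_le_bernstein_of_pos (hf : BddMeas f) {d : Fin n → ℝ}
    (hd : InteractionBound μ f d) {b j v t : ℝ} (hb0 : 0 < b) (hj : 0 < j) (hv0 : 0 < v)
    (hdj : ∑ l, d l ^ 2 ≤ j ^ 2) (hb : ∀ k x, f x - avg μ k f x ≤ b)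
    (hv : ∫ x, varSum μ f x ∂(Measure.pi fun _ => μ) ≤ v) (ht : 0 < t) :
    (Measure.pi fun _ : Fin n => μ).real {x | f x - ∫ x, f x ∂(Measure.pi fun _ => μ) > t}
      ≤ Real.exp (-t ^ 2 / (2 * v + (2 * b / 3 + j) * t)) := by
  set ν := (Measure.pi fun _ : Fin n => μ)
  set c := b / 3 + j / 2 with hc
  have hc0 : 0 < c := by positivity
  -- This s makes 1 - cs = v/(v + ct), and the Chernoff exponent becomes -t²/(2(v + ct)).
  set s := t / (v + c * t) with hs
  have hspos : 0 < s := by positivity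
  have h1c : 1 - c * s = v / (v + c * t) := by rw [hs]; field_simp; ring
  have hsc : c * s < 1 := by
    have : 0 < v / (v + c * t) := by positivity
    linarith
  have h1 := log_mgf_le_bernstein hf hd hb0 hj hdj hb hv hspos hsc
  have h2 := measure_ge_le_exp_cgf (X := f) (μ := ν) (∫ x, f x ∂ν + t) hspos.le
    ((hf.const_mul s).exp.integrable ν)
  have h3 : ν.real {x | f x - ∫ x, f x ∂ν > t} ≤ ν.real {x | ∫ x, f x ∂ν + t ≤ f x} := by
    refine measureReal_mono fun x hx => ?_
    simp only [Set.mem_ofPred_eq] at hx ⊢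
    linarith
  refine h3.trans (h2.trans (Real.exp_le_exp.2 ?_))
  change _ + Real.log (∫ x, Real.exp (s * f x) ∂ν) ≤ _
  rw [h1c] at h1
  have e : -s * (∫ x, f x ∂ν + t) + s * (∫ x, f x ∂ν + v / 2 * (s / (v / (v + c * t))))
      = -t ^ 2 / (2 * v + (2 * b / 3 + j) * t) := by
    have : 2 * v + (2 * b / 3 + j) * t = 2 * (v + c * t) := by rw [hc]; ring
    rw [this, hs]
    field_simp
    ring
  rw [← e]
  linarith

/-- A Bernstein inequality for functions of independent variables with bounded interaction. -/
theorem measureReal_le_bernstein (hf : BddMeas f) {d : Fin n → ℝ}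
    (hd : InteractionBound μ f d) {b j v t : ℝ} (hb0 : 0 < b) (hj : 0 ≤ j)
    (hdj : ∑ l, d l ^ 2 ≤ j ^ 2) (hb : ∀ k x, f x - avg μ k f x ≤ b)
    (hv : ∫ x, varSum μ f x ∂(Measure.pi fun _ => μ) ≤ v) (ht : 0 < t) :
    (Measure.pi fun _ : Fin n => μ).real {x | f x - ∫ x, f x ∂(Measure.pi fun _ => μ) > t}
      ≤ Real.exp (-t ^ 2 / (2 * v + (2 * b / 3 + j) * t)) := by
  have hv0 : 0 ≤ v := (integral_nonneg fun x => varSum_nonneg f x).trans hv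
  have hden : 2 * (v + 0) + (2 * b / 3 + (j + 0)) * t ≠ 0 := by positivity
  -- The cases v = 0 and j = 0 follow by replacing v and j with v + ε and j + ε and letting ε
  -- decrease to 0; b > 0 keeps the denominator positive in the limit.
  have hcont : ContinuousAt (fun ε : ℝ =>
      Real.exp (-t ^ 2 / (2 * (v + ε) + (2 * b / 3 + (j + ε)) * t))) 0 := by
    refine Real.continuous_exp.continuousAt.comp (ContinuousAt.div (by fun_prop) (by fun_prop) hden)
  have hlim := hcont.tendsto.mono_left (nhdsWithin_le_nhds (s := Set.Ioi 0))
  simp only [add_zero] at hlim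
  refine ge_of_tendsto hlim ?_
  filter_upwards [self_mem_nhdsWithin] with ε hε
  have hε' : 0 < ε := hε
  refine measureReal_le_bernstein_of_pos hf hd hb0 (by positivity) (by positivity)
    (hdj.trans ?_) hb (by linarith) ht
  gcongr
  linarith

end IncompleteU

/-! ### Mixed second differences, the quantities β and γ, and the first-order projection. -/

namespace IncompleteU

variable {𝒳 : Type*} [MeasurableSpace 𝒳] {n m M : ℕ} {μ : Measure 𝒳} [IsProbabilityMeasure μ]

section DoubleDifference

variable {f : (Fin n → 𝒳) → ℝ}

lemma D_comm {i j : Fin n} (h : i ≠ j) (a b c d : 𝒳) (f : (Fin n → 𝒳) → ℝ) (x : Fin n → 𝒳) :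
    D i a b (D j c d f) x = D j c d (D i a b f) x := by
  simp only [D, Function.update_comm h]
  ring

lemma BddMeas.DD_prod (hf : BddMeas f) (i j : Fin n) :
    BddMeas (fun p : (Fin n → 𝒳) × ((𝒳 × 𝒳) × (𝒳 × 𝒳)) =>
      IncompleteU.D i p.2.1.1 p.2.1.2 (IncompleteU.D j p.2.2.1 p.2.2.2 f) p.1) := by
  have h : ∀ φ : (Fin n → 𝒳) × ((𝒳 × 𝒳) × (𝒳 × 𝒳)) → 𝒳, Measurable φ →
      Measurable fun p : (Fin n → 𝒳) × ((𝒳 × 𝒳) × (𝒳 × 𝒳)) => Function.update p.1 i (φ p) :=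
    fun φ hφ => (measurable_update_prod i).comp (measurable_fst.prodMk hφ)
  exact ((hf.D_prod j).comp ((h _ (by fun_prop)).prodMk (by fun_prop))).sub
    ((hf.D_prod j).comp ((h _ (by fun_prop)).prodMk (by fun_prop)))

variable (μ) in
/-- `E[(D^i D^j f)²]`, with all arguments independent. -/
noncomputable def mixed (i j : Fin n) (f : (Fin n → 𝒳) → ℝ) : ℝ :=
  ∫ p : (Fin n → 𝒳) × ((𝒳 × 𝒳) × (𝒳 × 𝒳)),
    D i p.2.1.1 p.2.1.2 (D j p.2.2.1 p.2.2.2 f) p.1 ^ 2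
    ∂((Measure.pi fun _ : Fin n => μ).prod ((μ.prod μ).prod (μ.prod μ)))

lemma integral_integral_varCoord_D (hf : BddMeas f) (k l : Fin n) :
    ∫ z : 𝒳 × 𝒳, ∫ x, varCoord μ l (D k z.1 z.2 f) x ∂(Measure.pi fun _ => μ) ∂(μ.prod μ)
      = 1 / 2 * mixed μ l k f := by
  have h := (hf.DD_prod l k).sq
  rw [mixed, integral_prod _ (h.integrable _), integral_integral_swap]
  · simp only [varCoord]
    rw [← integral_const_mul]
    congr 1
    ext x
    rw [integral_const_mul]
    congr 1
    rw [integral_prod_symm (f := fun q : (𝒳 × 𝒳) × (𝒳 × 𝒳) =>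
      D l q.1.1 q.1.2 (D k q.2.1 q.2.2 f) x ^ 2)
      ((h.comp (φ := fun q => (x, q)) (measurable_const.prodMk measurable_id)).integrable _)]
  · have h1 := (h.comp (φ := fun p : ((𝒳 × 𝒳) × (Fin n → 𝒳)) × (𝒳 × 𝒳) => (p.1.2, (p.2, p.1.1)))
      (by fun_prop)).integral_right (μ.prod μ)
    exact (h1.const_mul (1 / 2)).integrable _

/-- The expected sum of conditional variances is controlled by the first-order projections and the
mixed second differences. -/
lemma integral_varSum_le (hf : BddMeas f) :
    ∫ x, varSum μ f x ∂(Measure.pi fun _ => μ)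
      ≤ ∑ k, (1 / 2 * ∫ z : 𝒳 × 𝒳, (∫ x, D k z.1 z.2 f x ∂(Measure.pi fun _ => μ)) ^ 2 ∂(μ.prod μ)
        + 1 / 4 * ∑ l ∈ Finset.univ.filter (fun l => k ≠ l), mixed μ l k f) := by
  simp only [varSum]
  rw [integral_finsetSum _ fun k _ => (hf.varCoord k).integrable _]
  refine Finset.sum_le_sum fun k _ => ?_
  have hsq := (hf.D_prod k).sq
  have hswap : BddMeas (fun p : (𝒳 × 𝒳) × (Fin n → 𝒳) => D k p.1.1 p.1.2 f p.2) :=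
    (hf.D_prod k).comp measurable_swap
  have e1 : ∫ x, varCoord μ k f x ∂(Measure.pi fun _ => μ) = 1 / 2 *
      ∫ z : 𝒳 × 𝒳, ∫ x, D k z.1 z.2 f x ^ 2 ∂(Measure.pi fun _ => μ) ∂(μ.prod μ) := by
    simp only [varCoord]
    rw [integral_const_mul, integral_integral_swap]
    exact hsq.integrable _
  have hv : ∀ l, BddMeas (fun z : 𝒳 × 𝒳 =>
      ∫ x, varCoord μ l (D k z.1 z.2 f) x ∂(Measure.pi fun _ => μ)) := fun l =>
    ((((hf.DD_prod l k).sq.comp (φ := fun p : ((𝒳 × 𝒳) × (Fin n → 𝒳)) × (𝒳 × 𝒳) =>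
      (p.1.2, (p.2, p.1.1))) (by fun_prop)).integral_right (μ.prod μ)).const_mul
        (1 / 2)).integral_right _
  have hm := (hswap.integral_right (Measure.pi fun _ => μ)).sq
  -- Efron–Stein is applied to the first difference of f for each fixed pair z.
  have e2 : ∫ z : 𝒳 × 𝒳, ∫ x, D k z.1 z.2 f x ^ 2 ∂(Measure.pi fun _ => μ) ∂(μ.prod μ)
      ≤ ∫ z : 𝒳 × 𝒳, ((∫ x, D k z.1 z.2 f x ∂(Measure.pi fun _ => μ)) ^ 2
        + ∑ l, ∫ x, varCoord μ l (D k z.1 z.2 f) x ∂(Measure.pi fun _ => μ)) ∂(μ.prod μ) :=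
    integral_mono ((hswap.sq.integral_right _).integrable _)
      ((hm.add (BddMeas.sum _ fun l _ => hv l)).integrable _)
      fun z => integral_sq_le_efronStein (hf.D k z.1 z.2)
  rw [integral_add (hm.integrable _) ((BddMeas.sum _ fun l _ => hv l).integrable _),
    integral_finsetSum _ fun l _ => (hv l).integrable _] at e2
  simp_rw [integral_integral_varCoord_D hf] at e2
  have e3 : ∑ l, 1 / 2 * mixed μ l k f
      = 1 / 2 * ∑ l ∈ Finset.univ.filter (fun l => k ≠ l), mixed μ l k f := by
    rw [← Finset.mul_sum, ← Finset.add_sum_erase _ _ (Finset.mem_univ k)]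
    -- A difference in the k-th argument no longer depends on that argument.
    have : mixed μ k k f = 0 := by simp [mixed, D]
    rw [this, zero_add]
    congr 2
    ext l
    simp [eq_comm]
  rw [e3] at e2
  rw [e1]
  linarith

end DoubleDifference

section Arguments

variable {K : (Fin m → 𝒳) → ℝ}

lemma D_comp_injective {e : Fin m → Fin n} (he : Function.Injective e) (j : Fin m) (y y' : 𝒳)
    (K : (Fin m → 𝒳) → ℝ) :
    D (e j) y y' (fun x => K fun i => x (e i)) = fun x => D j y y' K fun i => x (e i) := by
  ext x
  have h : ∀ z, (fun i => Function.update x (e j) z (e i))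
      = Function.update (fun i => x (e i)) j z := fun z =>
    Function.update_comp_eq_of_injective x he j z
  simp only [D, h]

lemma mixed_comp_injective (hK : BddMeas K) {e : Fin m → Fin n} (he : Function.Injective e)
    (i j : Fin m) : mixed μ (e i) (e j) (fun x => K fun i => x (e i)) = mixed μ i j K := by
  have h := (hK.DD_prod i j).sq
  have hmp := (measurePreserving_comp_injective μ he).prod
    (MeasurePreserving.id ((μ.prod μ).prod (μ.prod μ)))
  simp only [mixed, D_comp_injective he]
  conv_rhs => rw [← hmp.map_eq]
  rw [integral_map hmp.measurable.aemeasurable h.1.aestronglyMeasurable]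
  rfl

lemma measurePreserving_prodProdProdComm (μ : Measure 𝒳) [IsProbabilityMeasure μ] :
    MeasurePreserving (fun p : (𝒳 × 𝒳) × (𝒳 × 𝒳) => ((p.1.1, p.2.1), (p.1.2, p.2.2)))
      ((μ.prod μ).prod (μ.prod μ)) ((μ.prod μ).prod (μ.prod μ)) := by
  have h1 := measurePreserving_prodAssoc μ μ (μ.prod μ)
  have h2 := (measurePreserving_prodAssoc μ μ μ)
  have h3 : MeasurePreserving (Prod.map (Prod.swap : 𝒳 × 𝒳 → 𝒳 × 𝒳) (id : 𝒳 → 𝒳))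
      ((μ.prod μ).prod μ) ((μ.prod μ).prod μ) :=
    Measure.measurePreserving_swap.prod (MeasurePreserving.id μ)
  have h4 := (h2.comp h3).comp (h2.symm MeasurableEquiv.prodAssoc)
  exact ((h1.symm MeasurableEquiv.prodAssoc).comp ((MeasurePreserving.id μ).prod h4)).comp h1

/-- In `β` the substituted values X₁, X₂ are coordinates of the base point, whereas `mixed` uses
fresh copies. The double difference ignores those two coordinates of the base point, so integrating
over them first makes the copies fresh. -/
lemma β_eq_mixed (h : 2 ≤ m) (hK : BddMeas K) :
    β μ K = mixed μ (⟨0, by omega⟩ : Fin m) (⟨1, by omega⟩ : Fin m) K := by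
  rw [β, dif_pos h]
  set i : Fin m := ⟨0, by omega⟩
  set j : Fin m := ⟨1, by omega⟩
  have hij : i ≠ j := by simp [i, j, Fin.ext_iff]
  have hQ := (hK.DD_prod i j).sq
  have hG : BddMeas (fun p : (Fin m → 𝒳) × (𝒳 × 𝒳) =>
      D i (p.1 i) p.2.1 (D j (p.1 j) p.2.2 K) p.1 ^ 2) :=
    hQ.comp (φ := fun p : (Fin m → 𝒳) × (𝒳 × 𝒳) => (p.1, ((p.1 i, p.2.1), (p.1 j, p.2.2))))
      (by fun_prop)
  have hG' := hG.integral_right (μ.prod μ)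
  rw [integral_prod _ (hG.integrable _), mixed, integral_prod _ (hQ.integrable _),
    ← integral_avg hG' j, ← integral_avg (hG'.avg j) i]
  congr 1
  ext x
  have hupd : ∀ a b c d y w, D i a b (D j c d K) (Function.update (Function.update x i y) j w)
      = D i a b (D j c d K) x := fun a b c d y w => by
    rw [D_comm hij, D_update_self, ← D_comm hij, D_update_self]
  have hQx : BddMeas (fun q : (𝒳 × 𝒳) × (𝒳 × 𝒳) => D i q.1.1 q.1.2 (D j q.2.1 q.2.2 K) x ^ 2) :=
    hQ.comp (φ := fun q => (x, q)) (measurable_const.prodMk measurable_id)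
  have hmp := measurePreserving_prodProdProdComm μ
  conv_rhs => rw [← hmp.map_eq]
  have hQx' := hQx.comp hmp.measurable
  rw [integral_map hmp.measurable.aemeasurable hQx.1.aestronglyMeasurable,
    integral_prod _ (hQx'.integrable _), integral_prod _ ((hQx'.integral_right _).integrable _)]
  simp only [avg, hupd, Function.update_self, Function.update_of_ne hij]

/-- Without boundedness the real supremum in `γ` would take its default value 0 and bound nothing.
-/
lemma bddAbove_γ (hK : BddMeas K) (i j : Fin m) :
    BddAbove (Set.range fun q : (Fin m → 𝒳) × 𝒳 × 𝒳 =>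
      ∫ z : 𝒳 × 𝒳, D i q.2.1 q.2.2 (D j z.1 z.2 K) q.1 ^ 2 ∂(μ.prod μ)) := by
  obtain ⟨c, hc⟩ := (hK.DD_prod i j).sq.2
  refine ⟨c, ?_⟩
  rintro _ ⟨q, rfl⟩
  have := norm_integral_le_of_norm_le_const (μ := μ.prod μ)
    (f := fun z : 𝒳 × 𝒳 => D i q.2.1 q.2.2 (D j z.1 z.2 K) q.1 ^ 2) (C := c)
    (.of_forall fun z => hc (q.1, (q.2, z)))
  simpa using (le_abs_self _).trans this

lemma integral_D_D_le_γ (h : 2 ≤ m) (hK : BddMeas K) (x : Fin m → 𝒳) (y y' : 𝒳) :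
    ∫ z : 𝒳 × 𝒳, D (⟨0, by omega⟩ : Fin m) y y' (D (⟨1, by omega⟩ : Fin m) z.1 z.2 K) x ^ 2
      ∂(μ.prod μ) ≤ γ μ K := by
  rw [γ, dif_pos h]
  exact le_ciSup (bddAbove_γ hK _ _) (x, y, y')

lemma γ_nonneg (μ : Measure 𝒳) (K : (Fin m → 𝒳) → ℝ) : 0 ≤ γ μ K := by
  rw [γ]
  split_ifs
  · exact Real.iSup_nonneg fun q => integral_nonneg fun z => sq_nonneg _
  · exact le_rfl

lemma β_nonneg (μ : Measure 𝒳) (K : (Fin m → 𝒳) → ℝ) : 0 ≤ β μ K := by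
  rw [β]
  split_ifs
  · exact integral_nonneg fun z => sq_nonneg _
  · exact le_rfl

end Arguments

section FirstProjection

variable {K : (Fin m → 𝒳) → ℝ}

variable (μ) in
/-- The first-order projection `y ↦ E[K(y, X₂, …, X_m)]`, for the argument `i`. -/
noncomputable def proj (i : Fin m) (K : (Fin m → 𝒳) → ℝ) (y : 𝒳) : ℝ :=
  ∫ x, K (Function.update x i y) ∂(Measure.pi fun _ : Fin m => μ)

lemma BddMeas.proj (hK : BddMeas K) (i : Fin m) : BddMeas (proj μ i K) :=
  ((hK.update_prod i).comp measurable_swap).integral_right (Measure.pi fun _ : Fin m => μ)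

lemma integral_D_eq_proj (hK : BddMeas K) (i : Fin m) (y y' : 𝒳) :
    ∫ x, D i y y' K x ∂(Measure.pi fun _ : Fin m => μ) = proj μ i K y - proj μ i K y' := by
  have h : ∀ y, BddMeas (fun x => K (Function.update x i y)) := fun y =>
    (hK.update_prod i).comp (φ := fun x => (x, y)) (measurable_id.prodMk measurable_const)
  exact integral_sub ((h y).integrable _) ((h y').integrable _)

lemma integral_mul_proj (hK : BddMeas K) (i : Fin m) {c : 𝒳 → ℝ} (hc : BddMeas c) :
    ∫ x, c (x i) * K x ∂(Measure.pi fun _ : Fin m => μ)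
      = ∫ x, c (x i) * proj μ i K (x i) ∂(Measure.pi fun _ : Fin m => μ) := by
  have he := (measurePreserving_eval (fun _ : Fin m => μ) i)
  have hcK := (hc.comp (measurable_pi_apply (X := fun _ => 𝒳) i)).mul hK
  have e1 : ∫ x, c (x i) * proj μ i K (x i) ∂(Measure.pi fun _ : Fin m => μ)
      = ∫ y, c y * proj μ i K y ∂μ := by
    have := integral_map (μ := Measure.pi fun _ : Fin m => μ) he.measurable.aemeasurable
      (hc.mul (hK.proj (μ := μ) i)).1.aestronglyMeasurable
    rw [he.map_eq] at this
    exact this.symm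
  rw [e1, ← integral_avg hcK i]
  simp only [avg, Function.update_self]
  rw [integral_integral_swap]
  · congr 1
    ext y
    rw [integral_const_mul]
    rfl
  · exact ((hc.comp measurable_snd).mul (hK.update_prod i)).integrable _

lemma condExp_sigmaFirst_one (h : 1 ≤ m) (hK : BddMeas K) :
    condExp (sigmaFirst 𝒳 m 1) (Measure.pi fun _ : Fin m => μ) K
      =ᵐ[Measure.pi fun _ : Fin m => μ] fun x => proj μ ⟨0, h⟩ K (x ⟨0, h⟩) := by
  have hle : sigmaFirst 𝒳 m 1 ≤ MeasurableSpace.pi := by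
    rintro _ ⟨t, ht, rfl⟩
    exact (measurable_pi_lambda _ fun i => measurable_pi_apply i.1) ht
  have hq := (hK.proj (μ := μ) ⟨0, h⟩)
  have hq' := hq.comp (measurable_pi_apply (X := fun _ => 𝒳) (⟨0, h⟩ : Fin m))
  refine (ae_eq_condExp_of_forall_setIntegral_eq hle (hK.integrable _)
    (fun s _ _ => (hq'.integrable _).integrableOn) (fun s hs _ => ?_) ?_).symm
  · obtain ⟨t, ht, rfl⟩ := hs
    set r : (Fin m → 𝒳) → ({i : Fin m // (i : ℕ) < 1} → 𝒳) := fun x i => x i.1 with hr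
    have hrm : Measurable r := measurable_pi_lambda _ fun i => measurable_pi_apply i.1
    have hconst : Measurable (fun (y : 𝒳) (_ : {i : Fin m // (i : ℕ) < 1}) => y) :=
      measurable_pi_lambda _ fun _ => measurable_id
    set c : 𝒳 → ℝ := fun y => t.indicator (fun _ => (1 : ℝ)) fun _ => y with hcdef
    have hc : BddMeas c := by
      refine ⟨(measurable_const.indicator ht).comp hconst, 1, fun y => ?_⟩
      simp only [hcdef, Set.indicator]
      split_ifs <;> simp
    -- The index type of the first block has a single element, so events of `sigmaFirst 𝒳 m 1` are
    -- events in the coordinate 0.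
    have hrx : ∀ x, r x = fun _ => x ⟨0, h⟩ := fun x => by
      ext i
      have : i.1 = ⟨0, h⟩ := by
        have := i.2
        ext
        simp
        omega
      simp only [hr, this]
    have hind : ∀ G : (Fin m → 𝒳) → ℝ, (r ⁻¹' t).indicator G = fun x => c (x ⟨0, h⟩) * G x :=
      fun G => by
        ext x
        by_cases hx : x ∈ r ⁻¹' t
        · have hx' : (fun _ => x ⟨0, h⟩) ∈ t := by rw [← hrx]; exact hx
          simp [hcdef, hx, hx']
        · have hx' : (fun _ => x ⟨0, h⟩) ∉ t := by rw [← hrx]; exact hx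
          simp [hcdef, hx, hx']
    rw [← integral_indicator (hrm ht), ← integral_indicator (hrm ht), hind, hind]
    exact (integral_mul_proj hK _ hc).symm
  · refine Measurable.aestronglyMeasurable (m := sigmaFirst 𝒳 m 1) ?_
    have h0 : Measurable[sigmaFirst 𝒳 m 1] (fun x : Fin m → 𝒳 => x ⟨0, h⟩) := by
      have h1 : Measurable[sigmaFirst 𝒳 m 1]
        (fun (x : Fin m → 𝒳) (i : {i : Fin m // (i : ℕ) < 1}) => x i.1) := comap_measurable _
      exact (measurable_pi_apply (⟨⟨0, h⟩, by simp⟩ : {i : Fin m // (i : ℕ) < 1})).comp h1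
    exact hq.1.comp h0

lemma sigmaSq_one_eq (h : 1 ≤ m) (hK : BddMeas K) :
    sigmaSq μ K 1 = 1 / 2 * ∫ z : 𝒳 × 𝒳, (proj μ ⟨0, h⟩ K z.1 - proj μ ⟨0, h⟩ K z.2) ^ 2
      ∂(μ.prod μ) := by
  have hq := (hK.proj (μ := μ) ⟨0, h⟩)
  have he := (measurePreserving_eval (fun _ : Fin m => μ) ⟨0, h⟩)
  rw [half_integral_sub_sq μ hq, ← integral_sub_integral_sq μ hq, sigmaSq,
    variance_congr (condExp_sigmaFirst_one h hK),
    ← variance_eq_integral hq.1.aemeasurable]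
  have := variance_map (μ := Measure.pi fun _ : Fin m => μ) (Y := Function.eval ⟨0, h⟩)
    (X := proj μ ⟨0, h⟩ K) hq.1.aemeasurable he.measurable.aemeasurable
  rw [he.map_eq] at this
  exact this.symm

end FirstProjection

end IncompleteU

/-! ### The incomplete U-statistic: interaction bound, variance proxy and tail. -/

namespace IncompleteU

variable {𝒳 : Type*} [MeasurableSpace 𝒳] {n m M : ℕ} {μ : Measure 𝒳} [IsProbabilityMeasure μ]
  {K : (Fin m → 𝒳) → ℝ}

lemma exists_enum (hK : IsSymmetric K) (V : {W : Finset (Fin n) // W.card = m})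
    {k : Fin n} (hk : k ∈ V.1) (i : Fin m) :
    ∃ e : Fin m → Fin n, Function.Injective e ∧ e i = k ∧
      ∀ x : Fin n → 𝒳, K (restrict x V) = K fun j => x (e j) := by
  obtain ⟨a, ha⟩ : ∃ a, V.1.orderEmbOfFin V.2 a = k := by
    have : k ∈ Set.range (V.1.orderEmbOfFin V.2) := by simpa using hk
    exact this
  refine ⟨fun j => V.1.orderEmbOfFin V.2 (Equiv.swap i a j),
    (V.1.orderEmbOfFin V.2).injective.comp (Equiv.injective _), by simp [ha], fun x => ?_⟩
  exact (hK (Equiv.swap i a) (restrict x V)).symm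

/-- Symmetry lets any two chosen sample indices occupy prescribed slots of the kernel, so every
mixed difference reduces to the slots 0 and 1 used in `β` and `γ`. -/
lemma exists_enum_pair (hK : IsSymmetric K) (V : {W : Finset (Fin n) // W.card = m})
    {k l : Fin n} (hk : k ∈ V.1) (hl : l ∈ V.1) (hkl : k ≠ l) {i j : Fin m} (hij : i ≠ j) :
    ∃ e : Fin m → Fin n, Function.Injective e ∧ e i = k ∧ e j = l ∧
      ∀ x : Fin n → 𝒳, K (restrict x V) = K fun j => x (e j) := by
  have hmem : ∀ k ∈ V.1, ∃ a, V.1.orderEmbOfFin V.2 a = k := fun k hk => by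
    have : k ∈ Set.range (V.1.orderEmbOfFin V.2) := by simpa using hk
    exact this
  obtain ⟨a, ha⟩ := hmem k hk
  obtain ⟨b, hb⟩ := hmem l hl
  have hab : a ≠ b := by rintro rfl; exact hkl (ha.symm.trans hb)
  -- Swapping i and a sends c to b; since c ≠ i, a prior swap of j and c leaves i alone.
  set c := Equiv.swap i a b with hc
  have hci : i ≠ c := by
    intro h
    have : a = b := by
      have h2 := congrArg (Equiv.swap i a) h
      rwa [hc, Equiv.swap_apply_self, Equiv.swap_apply_left] at h2
    exact hab this
  set π : Equiv.Perm (Fin m) := (Equiv.swap j c).trans (Equiv.swap i a) with hπ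
  have hi : π i = a := by
    rw [hπ, Equiv.trans_apply, Equiv.swap_apply_of_ne_of_ne hij hci, Equiv.swap_apply_left]
  have hj : π j = b := by
    rw [hπ, Equiv.trans_apply, Equiv.swap_apply_left, hc, Equiv.swap_apply_self]
  refine ⟨fun j => V.1.orderEmbOfFin V.2 (π j),
    (V.1.orderEmbOfFin V.2).injective.comp (Equiv.injective _), by simp only [hi, ha],
    by simp only [hj, hb],
    fun x => ?_⟩
  exact (hK π (restrict x V)).symm

lemma measurable_restrict (V : {W : Finset (Fin n) // W.card = m}) :
    Measurable fun x : Fin n → 𝒳 => restrict x V :=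
  measurable_pi_lambda _ fun _ => measurable_pi_apply _

lemma BddMeas.comp_restrict (hK : BddMeas K) (V : {W : Finset (Fin n) // W.card = m}) :
    BddMeas fun x : Fin n → 𝒳 => K (restrict x V) :=
  hK.comp (measurable_restrict V)

lemma BddMeas.U (hK : BddMeas K) (W : Design n m M) : BddMeas (U K W) :=
  (BddMeas.sum _ fun i _ => hK.comp_restrict (W i)).const_mul _

lemma integral_U (hK : BddMeas K) (W : Design n m M) (hM : 1 ≤ M) :
    ∫ x, U K W x ∂(Measure.pi fun _ => μ) = θ μ K := by
  have h : ∀ V : {W : Finset (Fin n) // W.card = m},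
      ∫ x, K (restrict x V) ∂(Measure.pi fun _ => μ) = θ μ K := fun V => by
    have hmp := measurePreserving_comp_injective μ (V.1.orderEmbOfFin V.2).injective
    rw [θ, ← hmp.map_eq, integral_map hmp.measurable.aemeasurable hK.1.aestronglyMeasurable]
    rfl
  have hM' : (M : ℝ) ≠ 0 := by positivity
  simp only [U]
  rw [integral_const_mul, integral_finsetSum _ fun i _ => (hK.comp_restrict (W i)).integrable _]
  simp only [h, Finset.sum_const, Finset.card_univ, Fintype.card_fin, nsmul_eq_mul]
  field_simp

lemma restrict_update_of_notMem {V : {W : Finset (Fin n) // W.card = m}} {k : Fin n}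
    (hk : k ∉ V.1) (x : Fin n → 𝒳) (y : 𝒳) : restrict (Function.update x k y) V = restrict x V := by
  ext j
  simp only [restrict]
  rw [Function.update_of_ne]
  rintro rfl
  exact hk (by simp)

lemma D_restrict_eq_zero {V : {W : Finset (Fin n) // W.card = m}} {k : Fin n}
    (hk : k ∉ V.1) (K : (Fin m → 𝒳) → ℝ) (y y' : 𝒳) :
    D k y y' (fun x => K (restrict x V)) = fun _ => 0 := by
  ext x
  simp [D, restrict_update_of_notMem hk]

lemma D_U (W : Design n m M) (k : Fin n) (y y' : 𝒳) (x : Fin n → 𝒳) :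
    D k y y' (U K W) x = 1 / (M : ℝ) * ∑ i ∈ Finset.univ.filter (fun i => k ∈ (W i).1),
      D k y y' (fun x => K (restrict x (W i))) x := by
  rw [Finset.sum_filter_of_ne]
  · simp only [D, U, Finset.sum_sub_distrib]
    ring
  · intro i _ h
    by_contra hk
    exact h (by rw [D_restrict_eq_zero hk])

lemma D_D_U (W : Design n m M) (k l : Fin n) (y y' z z' : 𝒳) (x : Fin n → 𝒳) :
    D k y y' (D l z z' (U K W)) x
      = 1 / (M : ℝ) * ∑ i ∈ Finset.univ.filter (fun i => k ∈ (W i).1 ∧ l ∈ (W i).1),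
        D k y y' (D l z z' (fun x => K (restrict x (W i)))) x := by
  rw [Finset.sum_filter_of_ne]
  · simp only [D, U, Finset.sum_sub_distrib]
    ring
  · intro i _ h
    by_contra hkl
    refine h ?_
    by_cases hl : l ∈ (W i).1
    · have hk : k ∉ (W i).1 := fun hk => hkl ⟨hk, hl⟩
      rw [D_comm (by rintro rfl; exact hk hl), D_restrict_eq_zero hk]
      simp [D]
    · rw [D_restrict_eq_zero hl]
      simp [D]

/-- Only the `R₂ W k l` blocks containing both indices survive the double difference, and
Cauchy–Schwarz over them gives the square. The parametrization q covers both the case where every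
argument is random (β) and the case where all but one pair is frozen (γ). -/
lemma integral_D_D_U_sq_le (hK : BddMeas K) (W : Design n m M) (k l : Fin n) {α' : Type*}
    [MeasurableSpace α'] (ν : Measure α') [IsProbabilityMeasure ν]
    {q : α' → (Fin n → 𝒳) × ((𝒳 × 𝒳) × (𝒳 × 𝒳))} (hq : Measurable q) {c : ℝ}
    (h : ∀ i, k ∈ (W i).1 → l ∈ (W i).1 →
      ∫ a, D k (q a).2.1.1 (q a).2.1.2 (D l (q a).2.2.1 (q a).2.2.2
        (fun x => K (restrict x (W i)))) (q a).1 ^ 2 ∂ν ≤ c) :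
    ∫ a, D k (q a).2.1.1 (q a).2.1.2 (D l (q a).2.2.1 (q a).2.2.2 (U K W)) (q a).1 ^ 2 ∂ν
      ≤ (R₂ W k l : ℝ) ^ 2 / (M : ℝ) ^ 2 * c := by
  set I := Finset.univ.filter (fun i => k ∈ (W i).1 ∧ l ∈ (W i).1) with hI
  have hb : ∀ i, BddMeas fun a => D k (q a).2.1.1 (q a).2.1.2 (D l (q a).2.2.1 (q a).2.2.2
      (fun x => K (restrict x (W i)))) (q a).1 ^ 2 := fun i =>
    (((hK.comp_restrict (W i)).DD_prod k l).comp hq).sq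
  have hU : BddMeas fun a => D k (q a).2.1.1 (q a).2.1.2 (D l (q a).2.2.1 (q a).2.2.2
      (U K W)) (q a).1 ^ 2 := (((hK.U W).DD_prod k l).comp hq).sq
  have h1 := integral_mono (μ := ν) (hU.integrable _)
    (((BddMeas.sum I fun i _ => hb i).const_mul ((R₂ W k l : ℝ) / (M : ℝ) ^ 2)).integrable _)
    fun a => by
      simp only
      rw [D_D_U, mul_pow, div_pow, one_pow, one_div_mul_eq_div, div_mul_eq_mul_div]
      exact div_le_div_of_nonneg_right sq_sum_le_card_mul_sum_sq (by positivity)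
  rw [integral_const_mul, integral_finsetSum _ fun i _ => (hb i).integrable _] at h1
  refine h1.trans ?_
  have h2 : ∑ i ∈ I, ∫ a, D k (q a).2.1.1 (q a).2.1.2 (D l (q a).2.2.1 (q a).2.2.2
      (fun x => K (restrict x (W i)))) (q a).1 ^ 2 ∂ν ≤ (R₂ W k l : ℝ) * c := by
    refine (Finset.sum_le_card_nsmul I _ c fun i hi => ?_).trans (le_of_eq ?_)
    · rw [hI, Finset.mem_filter] at hi
      exact h i hi.2.1 hi.2.2
    · rw [nsmul_eq_mul]
      rfl
  calc _ ≤ (R₂ W k l : ℝ) / (M : ℝ) ^ 2 * ((R₂ W k l : ℝ) * c) :=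
        mul_le_mul_of_nonneg_left h2 (by positivity)
    _ = _ := by ring

lemma two_le_of_mem {V : {W : Finset (Fin n) // W.card = m}} {k l : Fin n} (hkl : k ≠ l)
    (hk : k ∈ V.1) (hl : l ∈ V.1) : 2 ≤ m := by
  rw [← V.2]
  exact Finset.one_lt_card.2 ⟨k, hk, l, hl, hkl⟩

lemma mixed_U_le (hK : BddMeas K) (hKs : IsSymmetric K) (W : Design n m M) {k l : Fin n}
    (hkl : k ≠ l) : mixed μ k l (U K W) ≤ (R₂ W k l : ℝ) ^ 2 / (M : ℝ) ^ 2 * β μ K := by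
  refine integral_D_D_U_sq_le hK W k l _ (q := id) measurable_id fun i hk hl => ?_
  have hm := two_le_of_mem hkl hk hl
  obtain ⟨e, he, rfl, rfl, hKe⟩ := exists_enum_pair hKs (W i) hk hl hkl
    (i := ⟨0, by omega⟩) (j := ⟨1, by omega⟩) (by simp)
  simp_rw [hKe]
  rw [β_eq_mixed hm hK, ← mixed_comp_injective hK he]
  rfl

lemma integral_D_D_U_le_γ (hK : BddMeas K) (hKs : IsSymmetric K) (W : Design n m M) {k l : Fin n}
    (hkl : k ≠ l) (x : Fin n → 𝒳) (y y' : 𝒳) :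
    ∫ z : 𝒳 × 𝒳, D k y y' (D l z.1 z.2 (U K W)) x ^ 2 ∂(μ.prod μ)
      ≤ (R₂ W k l : ℝ) ^ 2 / (M : ℝ) ^ 2 * γ μ K := by
  refine integral_D_D_U_sq_le hK W k l (μ.prod μ) (q := fun z => (x, ((y, y'), z))) (by fun_prop)
    fun i hk hl => ?_
  have hm := two_le_of_mem hkl hk hl
  obtain ⟨e, he, rfl, rfl, hKe⟩ := exists_enum_pair hKs (W i) hk hl hkl
    (i := ⟨0, by omega⟩) (j := ⟨1, by omega⟩) (by simp)
  simp_rw [hKe, D_comp_injective he]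
  exact integral_D_D_le_γ hm hK _ y y'

lemma R₂_comm (W : Design n m M) (k l : Fin n) : R₂ W k l = R₂ W l k := by
  simp only [R₂, and_comm]

lemma B_nonneg (W : Design n m M) : 0 ≤ B W :=
  Finset.sum_nonneg fun _ _ => Finset.sum_nonneg fun _ _ => by positivity

lemma interactionBound_U (hK : BddMeas K) (hKs : IsSymmetric K) (W : Design n m M) :
    InteractionBound μ (U K W) fun l => √(γ μ K / 2 *
      ∑ k ∈ Finset.univ.filter (fun k => l ≠ k), (R₂ W l k : ℝ) ^ 2 / (M : ℝ) ^ 2) := by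
  refine fun l => ⟨Real.sqrt_nonneg _, fun x y y' => ?_⟩
  have := γ_nonneg μ K
  rw [Real.sq_sqrt (mul_nonneg (by positivity) (Finset.sum_nonneg fun _ _ => by positivity)),
    Finset.mul_sum]
  refine Finset.sum_le_sum fun k hk => ?_
  have := integral_D_D_U_le_γ (μ := μ) hK hKs W (Finset.mem_filter.1 hk).2 x y y'
  linarith

lemma integral_D_U (hK : BddMeas K) (hKs : IsSymmetric K) (hm : 1 ≤ m) (W : Design n m M)
    (k : Fin n) (y y' : 𝒳) :
    ∫ x, D k y y' (U K W) x ∂(Measure.pi fun _ => μ)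
      = (R W k : ℝ) / M * (proj μ ⟨0, hm⟩ K y - proj μ ⟨0, hm⟩ K y') := by
  simp_rw [D_U]
  rw [integral_const_mul, integral_finsetSum _ fun i _ =>
    ((hK.comp_restrict (W i)).D k y y').integrable _]
  rw [Finset.sum_congr rfl (g := fun _ => proj μ ⟨0, hm⟩ K y - proj μ ⟨0, hm⟩ K y'),
    Finset.sum_const, nsmul_eq_mul, ← mul_assoc, one_div_mul_eq_div]
  · rfl
  · intro i hi
    obtain ⟨e, he, rfl, hKe⟩ := exists_enum hKs (W i) (Finset.mem_filter.1 hi).2 ⟨0, hm⟩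
    simp_rw [hKe, D_comp_injective he]
    have hmp := measurePreserving_comp_injective μ he
    rw [← integral_D_eq_proj hK, ← integral_map (f := D (⟨0, hm⟩ : Fin m) y y' K)
      hmp.measurable.aemeasurable (hK.D _ y y').1.aestronglyMeasurable, hmp.map_eq]

lemma integral_varSum_U_le (hK : BddMeas K) (hKs : IsSymmetric K) (hm : 1 ≤ m)
    (W : Design n m M) :
    ∫ x, varSum μ (U K W) x ∂(Measure.pi fun _ => μ)
      ≤ A W * sigmaSq μ K 1 + B W * β μ K / 4 := by
  refine (integral_varSum_le (hK.U W)).trans ?_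
  have e : A W * sigmaSq μ K 1 + B W * β μ K / 4
      = ∑ k, ((R W k : ℝ) ^ 2 / (M : ℝ) ^ 2 * sigmaSq μ K 1
        + 1 / 4 * ∑ l ∈ Finset.univ.filter (fun l => k ≠ l),
          (R₂ W k l : ℝ) ^ 2 / (M : ℝ) ^ 2 * β μ K) := by
    rw [A, B, Finset.sum_add_distrib, Finset.sum_mul, ← Finset.mul_sum]
    simp_rw [← Finset.sum_mul]
    ring
  rw [e]
  refine Finset.sum_le_sum fun k _ => add_le_add (le_of_eq ?_) ?_
  · simp_rw [integral_D_U hK hKs hm, mul_pow]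
    rw [integral_const_mul, sigmaSq_one_eq hm hK]
    ring
  · refine mul_le_mul_of_nonneg_left (Finset.sum_le_sum fun l hl => ?_) (by norm_num)
    rw [R₂_comm]
    exact mixed_U_le hK hKs W (Finset.mem_filter.1 hl).2.symm

lemma le_C (W : Design n m M) (k : Fin n) : (R W k : ℝ) / M ≤ C W :=
  le_ciSup (f := fun k => (R W k : ℝ) / (M : ℝ)) (Set.finite_range _).bddAbove k

lemma C_pos (W : Design n m M) (hm : 1 ≤ m) (hM : 1 ≤ M) : 0 < C W := by
  have hne : (W ⟨0, hM⟩).1.Nonempty := by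
    rw [← Finset.card_pos, (W ⟨0, hM⟩).2]
    exact hm
  obtain ⟨k, hk⟩ := hne
  have hR : 0 < R W k := Finset.card_pos.2 ⟨⟨0, hM⟩, by simp [hk]⟩
  have hM' : 0 < (M : ℝ) := by exact_mod_cast hM
  have : 0 < (R W k : ℝ) / M := by positivity
  exact this.trans_le (le_C W k)

lemma U_sub_avg_le (hK : BddMeas K) (hKb : ∀ x, K x ∈ Set.Icc (-1 : ℝ) 1) (W : Design n m M)
    (k : Fin n) (x : Fin n → 𝒳) : U K W x - avg μ k (U K W) x ≤ 2 * C W := by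
  have hD : ∀ y, U K W x - 2 * C W ≤ U K W (Function.update x k y) := fun y => by
    have h1 := D_U (K := K) W k (x k) y x
    rw [D, Function.update_eq_self] at h1
    have h2 : ∑ i ∈ Finset.univ.filter (fun i => k ∈ (W i).1),
        D k (x k) y (fun x => K (restrict x (W i))) x ≤ (R W k : ℝ) * 2 := by
      refine (Finset.sum_le_card_nsmul _ _ 2 fun i _ => ?_).trans (le_of_eq ?_)
      · simp only [D]
        linarith [(hKb (restrict (Function.update x k (x k)) (W i))).2,
          (hKb (restrict (Function.update x k y) (W i))).1]
      · rw [nsmul_eq_mul]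
        rfl
    have h3 : 1 / (M : ℝ) * ((R W k : ℝ) * 2) ≤ 2 * C W := by
      have := le_C W k
      calc _ = (R W k : ℝ) / M * 2 := by ring
        _ ≤ _ := by linarith
    have h4 := mul_le_mul_of_nonneg_left h2 (show (0 : ℝ) ≤ 1 / (M : ℝ) by positivity)
    linarith
  have := integral_mono (μ := μ) ((BddMeas.const (U K W x - 2 * C W)).integrable μ)
    (((hK.U W).update k x).integrable μ) hD
  simp only [integral_const, probReal_univ, one_smul] at this
  change _ ≤ avg μ k (U K W) x at this
  linarith

lemma bddMeas_of_mem_Icc (hKm : Measurable K) (hKb : ∀ x, K x ∈ Set.Icc (-1 : ℝ) 1) : BddMeas K :=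
  ⟨hKm, 1, fun x => abs_le.2 (hKb x)⟩

/-- The exponential tail bound for the incomplete U-statistic, under the product law. -/
lemma measureReal_pi_U_le (hm : 1 ≤ m) (hM : 1 ≤ M) (hKm : Measurable K) (hKs : IsSymmetric K)
    (hKb : ∀ x, K x ∈ Set.Icc (-1 : ℝ) 1) (W : Design n m M) {t : ℝ} (ht : 0 < t) :
    (Measure.pi fun _ : Fin n => μ).real {x | U K W x - θ μ K > t} ≤
      Real.exp (-t ^ 2 / (2 * A W * sigmaSq μ K 1 + B W * β μ K / 2
        + (√(B W * γ μ K) + 4 * C W / 3) * t)) := by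
  have hK := bddMeas_of_mem_Icc hKm hKb
  have hγ := γ_nonneg μ K
  have hB := B_nonneg W
  -- The sum equals Bγ/2; the weaker bound Bγ is all that the stated constant requires.
  have hsum : ∑ l, √(γ μ K / 2 * ∑ k ∈ Finset.univ.filter (fun k => l ≠ k),
      (R₂ W l k : ℝ) ^ 2 / (M : ℝ) ^ 2) ^ 2 ≤ √(B W * γ μ K) ^ 2 := by
    have e : ∀ l, √(γ μ K / 2 * ∑ k ∈ Finset.univ.filter (fun k => l ≠ k),
        (R₂ W l k : ℝ) ^ 2 / (M : ℝ) ^ 2) ^ 2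
        = γ μ K / 2 * ∑ k ∈ Finset.univ.filter (fun k => l ≠ k),
          (R₂ W l k : ℝ) ^ 2 / (M : ℝ) ^ 2 := fun l =>
      Real.sq_sqrt (mul_nonneg (by positivity) (Finset.sum_nonneg fun _ _ => by positivity))
    simp_rw [e]
    rw [← Finset.mul_sum, Real.sq_sqrt (mul_nonneg hB hγ)]
    change γ μ K / 2 * B W ≤ _
    nlinarith [mul_nonneg hB hγ]
  have key := measureReal_le_bernstein (hK.U W) (interactionBound_U (μ := μ) hK hKs W)
    (b := 2 * C W) (by linarith [C_pos W hm hM]) (Real.sqrt_nonneg _) hsum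
    (U_sub_avg_le hK hKb W) (integral_varSum_U_le hK hKs hm W) ht
  rw [integral_U hK W hM] at key
  refine key.trans (le_of_eq ?_)
  congr 2
  ring

lemma sigmaSq_nonneg (μ : Measure 𝒳) (K : (Fin m → 𝒳) → ℝ) (k : ℕ) : 0 ≤ sigmaSq μ K k :=
  variance_nonneg _ _

lemma A_nonneg (W : Design n m M) : 0 ≤ A W :=
  Finset.sum_nonneg fun _ _ => by positivity

/-- Solving a Bernstein tail bound for the deviation. -/
lemma exp_bernstein_le {V c δ t : ℝ} (hV : 0 ≤ V) (hc : 0 < c) (hδ : 0 < δ) (hL : 1 ≤ Real.log (1 / δ))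
    (ht : √(V * Real.log (1 / δ)) + c * Real.log (1 / δ) ≤ t) :
    Real.exp (-t ^ 2 / (V + c * t)) ≤ δ := by
  set L := Real.log (1 / δ) with hLdef
  have hs := Real.sqrt_nonneg (V * L)
  have hss : √(V * L) ^ 2 = V * L := Real.sq_sqrt (by positivity)
  have hcL : 0 < c * L := by positivity
  have ht0 : 0 < t := by linarith
  have hlog : δ = Real.exp (-L) := by
    rw [hLdef, one_div, Real.log_inv, neg_neg, Real.exp_log hδ]
  rw [hlog]
  refine Real.exp_le_exp.2 ?_
  rw [neg_div, neg_le_neg_iff, le_div_iff₀ (by positivity)]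
  -- The chain is t² ≥ √(VL) t + cLt ≥ VL + cLt, using the hypothesis on t twice.
  nlinarith [mul_le_mul_of_nonneg_left ht hs, mul_le_mul_of_nonneg_right ht ht0.le]

/-- The deviation that a Bernstein bound gives, with the variance terms separated. -/
lemma sqrt_add_bernstein_le {S Bv bt gm Cv L : ℝ} (hS : 0 ≤ S) (hB : 0 ≤ Bv) (hβ : 0 ≤ bt)
    (hL : 1 ≤ L) :
    √((S + Bv * bt / 2) * L) + (√(Bv * gm) + 4 * Cv / 3) * L
      ≤ √(S * L) + ((√(bt / 2) + √gm) * √Bv + 4 * Cv / 3) * L := by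
  have h0 : 0 ≤ L := by linarith
  have h1 : √((S + Bv * bt / 2) * L) ≤ √(S * L) + √(Bv * bt / 2 * L) := by
    rw [add_mul]
    have a := Real.sq_sqrt (show 0 ≤ S * L by positivity)
    have b := Real.sq_sqrt (show 0 ≤ Bv * bt / 2 * L by positivity)
    refine Real.sqrt_le_iff.2 ⟨by positivity, ?_⟩
    nlinarith [mul_nonneg (Real.sqrt_nonneg (S * L)) (Real.sqrt_nonneg (Bv * bt / 2 * L))]
  have h2 : √(Bv * bt / 2 * L) ≤ √(bt / 2) * √Bv * L := by
    rw [show Bv * bt / 2 * L = bt / 2 * Bv * L by ring, Real.sqrt_mul (by positivity),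
      Real.sqrt_mul (by positivity)]
    refine mul_le_mul_of_nonneg_left ?_ (by positivity)
    -- This is √L ≤ L, where L ≥ 1 enters.
    rw [Real.sqrt_le_left h0]
    nlinarith
  rw [Real.sqrt_mul hB]
  linarith

end IncompleteU

theorem mainTheorem1 {𝒳 : Type*} [MeasurableSpace 𝒳] (μ : Measure 𝒳) [IsProbabilityMeasure μ]
    {n m M : ℕ} (hm : 1 ≤ m) (hmn : m < n) (hM : 1 ≤ M)
    (K : (Fin m → 𝒳) → ℝ) (hKmeas : Measurable K) (hKsymm : IncompleteU.IsSymmetric K)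
    (hKbound : ∀ x, K x ∈ Set.Icc (-1 : ℝ) 1)
    (W : IncompleteU.Design n m M)
    {Ω : Type*} [MeasurableSpace Ω] (P : Measure Ω) [IsProbabilityMeasure P]
    (X : Ω → Fin n → 𝒳) (hX : HasLaw X (Measure.pi fun _ : Fin n => μ) P) :
    (∀ t : ℝ, 0 < t →
      P.real {ω | IncompleteU.U K W (X ω) - IncompleteU.θ μ K > t} ≤
        Real.exp (-t ^ 2 /
          (2 * IncompleteU.A W * IncompleteU.sigmaSq μ K 1
            + IncompleteU.B W * IncompleteU.β μ K / 2
            + (√(IncompleteU.B W * IncompleteU.γ μ K) + 4 * IncompleteU.C W / 3) * t))) ∧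
    (∀ δ : ℝ, 0 < δ → δ ≤ 1 / Real.exp 1 →
      P.real {ω | IncompleteU.U K W (X ω) - IncompleteU.θ μ K ≤
          √(2 * IncompleteU.A W * IncompleteU.sigmaSq μ K 1 * Real.log (1 / δ))
            + (IncompleteU.α μ K * √(IncompleteU.B W) + 4 * IncompleteU.C W / 3)
              * Real.log (1 / δ)} ≥ 1 - δ) := by
  open IncompleteU in
  have hUm : Measurable (U K W) := ((bddMeas_of_mem_Icc hKmeas hKbound).U W).1
  have htail : ∀ t : ℝ, 0 < t → P.real {ω | U K W (X ω) - θ μ K > t} ≤ _ := fun t ht =>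
    (hX.measureReal_eq (p := fun x => U K W x - θ μ K > t)
      (measurableSet_lt measurable_const (hUm.sub_const _))).le.trans
      (measureReal_pi_U_le hm hM hKmeas hKsymm hKbound W ht)
  refine ⟨htail, fun δ hδ hδe => ?_⟩
  have hL : 1 ≤ Real.log (1 / δ) := by
    rw [Real.le_log_iff_exp_le (by positivity), le_one_div (Real.exp_pos 1) hδ]
    exact hδe
  have hA := mul_nonneg (mul_nonneg zero_le_two (A_nonneg W)) (sigmaSq_nonneg μ K 1)
  have hB := B_nonneg W
  have hβ := β_nonneg μ K
  have hC := C_pos W hm hM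
  have hdev := sqrt_add_bernstein_le (gm := γ μ K) (Cv := C W) hA hB hβ hL
  set s := √(2 * A W * sigmaSq μ K 1 * Real.log (1 / δ))
    + ((√(β μ K / 2) + √(γ μ K)) * √(B W) + 4 * C W / 3) * Real.log (1 / δ) with hs
  have hc : 0 < √(B W * γ μ K) + 4 * C W / 3 := by positivity
  have hs0 : 0 < s := lt_of_lt_of_le (by positivity) hdev
  have h1 := (htail s hs0).trans (exp_bernstein_le (by positivity) hc hδ hL hdev)
  have hcompl : {ω | U K W (X ω) - θ μ K ≤ s} = {ω | U K W (X ω) - θ μ K > s}ᶜ := by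
    ext ω
    simp
  have hnull : NullMeasurableSet {ω | U K W (X ω) - θ μ K > s} P :=
    nullMeasurableSet_lt aemeasurable_const ((hUm.comp_aemeasurable hX.aemeasurable).sub_const _)
  change P.real {ω | U K W (X ω) - θ μ K ≤ s} ≥ 1 - δ
  rw [hcompl, probReal_compl_eq_one_sub₀ hnull]
  linarith
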